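/- Let $d,r,M\ge 0$ be integers and let $m=(m_1,\dots,m_\ell)$, $\ell\ge 1$, be integers with $m_i\ge r$ for all $i$ and $m_1+\dots+m_\ell=M$. A geometric $m$-spline of regularity $r$ in $\mathbb R^d$ is a concatenation $X=X^{[1]}\sqcup\dots\sqcup X^{[\ell]}:[0,1]\to\mathbb R^d$ of polynomial paths $X^{[i]}:[0,\tfrac1\ell]\to\mathbb R^d$ whose coordinates have degree at most $m_i$, such that for all $1\le i\le \ell-1$ and $1\le s\le r$ there is some $\rho_{i,s}>0$ with $\rho_{i,s}\,\frac{\mathrm d^sX^{[i]}}{\mathrm dt^s}(\tfrac1\ell)=\frac{\mathrm d^sX^{[i+1]}}{\mathrm dt^s}(0)$; it is parametric if this holds with all $\rho_{i,s}=1$. (Here $Y\sqcup Z$ runs through $Y$ and then through the translate of $Z$ that starts at the endpoint of $Y$.) Let $\mathcal S^r_{d,2,m}$ (respectively $\mathcal P^r_{d,2,m}$) be the Zariski closure in $\mathbb C^{d\times d}$ of the set of second-level signature matrices $$\Big(\int_0^1\!\int_0^{t_2}\dot X_{i}(t_1)\,\dot X_{j}(t_2)\,\mathrm dt_1\,\mathrm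 dt_2\Big)_{1\le i,j\le d}$$ of all geometric (respectively parametric) $m$-splines $X$ of regularity $r$ in $\mathbb R^d$. Put $n:=M-(\ell-1)r$. If $n\le d+1$, then $$\dim \mathcal S^r_{d,2,m}=\dim\mathcal P^r_{d,2,m}=Md-(\ell-1)dr-\binom{M-(\ell-1)r}{2}.$$ If $n\ge d$, then $$\dim \mathcal S^r_{d,2,m}=\dim\mathcal P^r_{d,2,m}=\binom{d+1}{2}.$$ -/

import Mathlib

open MeasureTheory

noncomputable section

namespace SplineSignature

/-! ### Compositions and splines -/

/-- `m = (m₁, …, m_ℓ)` is a composition of `M` of length `ℓ ≥ 1` with all entries `≥ r`. -/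
def IsComp (r M : ℕ) {ℓ : ℕ} (m : Fin ℓ → ℕ) : Prop :=
  0 < ℓ ∧ (∀ i, r ≤ m i) ∧ ∑ i, m i = M

/-- On `[0,1]`, the path `X` is the concatenation `X^[1] ⊔ ⋯ ⊔ X^[ℓ]` of the polynomial paths
`p i : [0, 1/ℓ] → ℝ^d`: it starts as the first piece, and on `[i/ℓ, (i+1)/ℓ]` it is the `i`-th
piece, translated so that `X` is continuous. -/
def IsConcat {d ℓ : ℕ} (p : Fin ℓ → Fin d → Polynomial ℝ) (X : ℝ → Fin d → ℝ) : Prop :=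
  (∀ i : Fin ℓ, (i : ℕ) = 0 → ∀ a, X 0 a = (p i a).eval 0) ∧
  ∀ (i : Fin ℓ), ∀ t ∈ Set.Icc (0 : ℝ) (1 / (ℓ : ℝ)), ∀ a,
    X ((i : ℝ) / (ℓ : ℝ) + t) a
      = X ((i : ℝ) / (ℓ : ℝ)) a - (p i a).eval 0 + (p i a).eval t

/-- The regularity condition at the control points, with weights `ρ i s`:
`ρ_{i,s} (d^s X^[i] / dt^s)(1/ℓ) = (d^s X^[i+1] / dt^s)(0)` for consecutive pieces and
`1 ≤ s ≤ r`. -/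
def SmoothAt {d ℓ : ℕ} (r : ℕ) (p : Fin ℓ → Fin d → Polynomial ℝ) (ρ : Fin ℓ → ℕ → ℝ) : Prop :=
  ∀ i j : Fin ℓ, (j : ℕ) = (i : ℕ) + 1 → ∀ s : ℕ, 1 ≤ s → s ≤ r → ∀ a : Fin d,
    ρ i s * (Polynomial.derivative^[s] (p i a)).eval (1 / (ℓ : ℝ))
      = (Polynomial.derivative^[s] (p j a)).eval 0

/-- Geometric `m`-splines of regularity `r` in `ℝ^d`. -/
def geometricSplines (d r : ℕ) {ℓ : ℕ} (m : Fin ℓ → ℕ) : Set (ℝ → Fin d → ℝ) :=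
  {X | ∃ p : Fin ℓ → Fin d → Polynomial ℝ, IsConcat p X ∧
    (∀ i a, (p i a).natDegree ≤ m i) ∧
    ∃ ρ : Fin ℓ → ℕ → ℝ, (∀ i s, 0 < ρ i s) ∧ SmoothAt r p ρ}

/-- Parametric `m`-splines of regularity `r` in `ℝ^d`. -/
def parametricSplines (d r : ℕ) {ℓ : ℕ} (m : Fin ℓ → ℕ) : Set (ℝ → Fin d → ℝ) :=
  {X | ∃ p : Fin ℓ → Fin d → Polynomial ℝ, IsConcat p X ∧
    (∀ i a, (p i a).natDegree ≤ m i) ∧ SmoothAt r p (fun _ _ => 1)}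

/-! ### Signatures -/

/-- The iterated integral of `X` over `0 ≤ t₁ ≤ ⋯ ≤ t_j ≤ t` along the word `w = i₁ … i_j`. -/
def iteratedIntegral {d : ℕ} (X : ℝ → Fin d → ℝ) : (j : ℕ) → (Fin j → Fin d) → ℝ → ℝ
  | 0, _, _ => 1
  | j + 1, w, t => ∫ s in (0 : ℝ)..t,
      iteratedIntegral X j (fun i => w i.castSucc) s * deriv (fun u => X u (w (Fin.last j))) s

/-- Words of length at most `k` in `d` letters; they index the coordinates of `T^{≤k}`. -/
abbrev Word (d k : ℕ) : Type := Σ j : Fin (k + 1), (Fin (j : ℕ) → Fin d)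

/-- The `k`-truncated signature of a path `X` on `[0,1]`, as a point of `T^{≤k}(ℂ^d)`. -/
def signature {d : ℕ} (k : ℕ) (X : ℝ → Fin d → ℝ) : Word d k → ℂ :=
  fun w => (iteratedIntegral X (w.1 : ℕ) w.2 1 : ℂ)

/-! ### Varieties -/

/-- The Zariski closure of a subset of the affine space `ℂ^σ`. -/
def zariskiClosure {σ : Type} (S : Set (σ → ℂ)) : Set (σ → ℂ) :=
  MvPolynomial.zeroLocus ℂ (MvPolynomial.vanishingIdeal ℂ S)

/-- The dimension of a Zariski closed subset of `ℂ^σ`: the Krull dimension of its coordinate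
ring. -/
def varietyDim {σ : Type} (Z : Set (σ → ℂ)) : WithBot ℕ∞ :=
  ringKrullDim (MvPolynomial σ ℂ ⧸ (MvPolynomial.vanishingIdeal ℂ Z : Ideal (MvPolynomial σ ℂ)))

/-- The signature variety in `T^{≤k}(ℂ^d)` of a class of paths. -/
def signatureVariety {d : ℕ} (k : ℕ) (P : Set (ℝ → Fin d → ℝ)) : Set (Word d k → ℂ) :=
  zariskiClosure (signature k '' P)

/-- The projection of `T^{≤k}(ℂ^d)` to the space of `k`-tensors `(ℂ^d)^{⊗k}`. -/
def toLevel {d : ℕ} (k : ℕ) (x : Word d k → ℂ) : (Fin k → Fin d) → ℂ :=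
  fun w => x ⟨Fin.last k, w⟩

/-- The variety of level `k` signature tensors of a class of paths: the Zariski image of the
signature variety under the projection to `(ℂ^d)^{⊗k}`. -/
def tensorVariety {d : ℕ} (k : ℕ) (P : Set (ℝ → Fin d → ℝ)) : Set ((Fin k → Fin d) → ℂ) :=
  zariskiClosure (toLevel k '' signatureVariety k P)

/-- The variety `𝒮^r_{d,k,m}` of level `k` signature tensors of geometric splines. -/
def geometricVariety (d k r : ℕ) {ℓ : ℕ} (m : Fin ℓ → ℕ) : Set ((Fin k → Fin d) → ℂ) :=
  tensorVariety k (geometricSplines d r m)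

/-- The variety `𝒫^r_{d,k,m}` of level `k` signature tensors of parametric splines. -/
def parametricVariety (d k r : ℕ) {ℓ : ℕ} (m : Fin ℓ → ℕ) : Set ((Fin k → Fin d) → ℂ) :=
  tensorVariety k (parametricSplines d r m)

end SplineSignature

end

open MeasureTheory

noncomputable section

namespace SplineSignature

open Polynomial

/-! ### Alternating sign patterns and Rolle's theorem -/

/-- `f` takes values of alternating signs at `k` increasing points of `S`. -/
def Alternates (f : ℝ → ℝ) (k : ℕ) (S : Set ℝ) : Prop :=
  ∃ x : ℕ → ℝ, ∃ ε : ℝ, (ε = 1 ∨ ε = -1) ∧ (∀ i < k, x i ∈ S) ∧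
    (∀ i, i + 1 < k → x i < x (i + 1)) ∧ ∀ i < k, 0 < ε * (-1) ^ i * f (x i)

theorem Alternates.congr {f g : ℝ → ℝ} {k : ℕ} {S : Set ℝ} (h : Alternates f k S)
    (hfg : ∀ x ∈ S, f x = g x) : Alternates g k S := by
  obtain ⟨x, ε, hε, hx, hlt, hs⟩ := h
  exact ⟨x, ε, hε, hx, hlt, fun i hi => hfg _ (hx i hi) ▸ hs i hi⟩

theorem Alternates.comp_add {f : ℝ → ℝ} {k : ℕ} {a b c : ℝ}
    (h : Alternates (fun t => f (c + t)) k (Set.Ico a b)) :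
    Alternates f k (Set.Ico (c + a) (c + b)) := by
  obtain ⟨x, ε, hε, hx, hlt, hs⟩ := h
  refine ⟨fun i => c + x i, ε, hε, fun i hi => ?_, fun i hi => ?_, hs⟩
  · have := hx i hi
    simp only [Set.mem_Ico] at this ⊢
    constructor <;> linarith
  · have := hlt i hi
    simp only
    linarith

theorem Alternates.sub_comp {f : ℝ → ℝ} {k : ℕ} {a b c : ℝ}
    (h : Alternates f k (Set.Ico (c + a) (c + b))) :
    Alternates (fun t => f (c + t)) k (Set.Ico a b) := by
  obtain ⟨x, ε, hε, hx, hlt, hs⟩ := h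
  refine ⟨fun i => x i - c, ε, hε, fun i hi => ?_, fun i hi => ?_, fun i hi => ?_⟩
  · have := hx i hi
    simp only [Set.mem_Ico] at this ⊢
    constructor <;> linarith
  · have := hlt i hi
    simp only
    linarith
  · simpa using hs i hi

/-- At the junction the two neighbouring signs either agree, and one point is dropped, or differ,
and the chains concatenate. Joining costs at most one alternation. -/
theorem Alternates.append {f : ℝ → ℝ} {k l : ℕ} {a b c : ℝ} (hab : a ≤ b) (hbc : b ≤ c)
    (h₁ : Alternates f (k + 1) (Set.Ico a b)) (h₂ : Alternates f (l + 1) (Set.Ico b c)) :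
    Alternates f (k + l + 1) (Set.Ico a c) := by
  obtain ⟨x, ε, hε, hx, hxlt, hxs⟩ := h₁
  obtain ⟨y, δ, hδ, hy, hylt, hys⟩ := h₂
  have hk : ((-1 : ℝ) ^ k = 1 ∨ (-1 : ℝ) ^ k = -1) := neg_one_pow_eq_or ℝ k
  have key : δ = ε * (-1) ^ k ∨ δ = ε * (-1) ^ (k + 1) := by
    rw [pow_succ]
    rcases hε with rfl | rfl <;> rcases hδ with rfl | rfl <;> rcases hk with h | h <;>
      rw [h] <;> norm_num
  have hxS : ∀ i < k + 1, x i ∈ Set.Ico a c := fun i hi =>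
    ⟨(hx i hi).1, (hx i hi).2.trans_le hbc⟩
  have hyS : ∀ i < l + 1, y i ∈ Set.Ico a c := fun i hi =>
    ⟨hab.trans (hy i hi).1, (hy i hi).2⟩
  rcases key with h | h
  · refine ⟨fun i => if i < k + 1 then x i else y (i - k), ε, hε, ?_, ?_, ?_⟩
    · intro i hi
      simp only
      split_ifs with h1
      · exact hxS i h1
      · exact hyS _ (by omega)
    · intro i hi
      simp only
      split_ifs with h1 h2
      · exact hxlt i h2
      · exact (hx i h1).2.trans_le (hy _ (by omega)).1
      · omega
      · have := hylt (i - k) (by omega)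
        rwa [show i - k + 1 = i + 1 - k by omega] at this
    · intro i hi
      simp only
      split_ifs with h1
      · exact hxs i h1
      · have := hys (i - k) (by omega)
        rw [h, mul_assoc ε, ← pow_add, show k + (i - k) = i by omega] at this
        exact this
  · refine ⟨fun i => if i < k + 1 then x i else y (i - (k + 1)), ε, hε, ?_, ?_, ?_⟩
    · intro i hi
      simp only
      split_ifs with h1
      · exact hxS i h1
      · exact hyS _ (by omega)
    · intro i hi
      simp only
      split_ifs with h1 h2
      · exact hxlt i h2
      · exact (hx i h1).2.trans_le (hy _ (by omega)).1
      · omega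
      · have := hylt (i - (k + 1)) (by omega)
        rwa [show i - (k + 1) + 1 = i + 1 - (k + 1) by omega] at this
    · intro i hi
      simp only
      split_ifs with h1
      · exact hxs i h1
      · have := hys (i - (k + 1)) (by omega)
        rw [h, mul_assoc ε, ← pow_add, show k + 1 + (i - (k + 1)) = i by omega] at this
        exact this

theorem Alternates.split {f : ℝ → ℝ} {k : ℕ} {a b c : ℝ}
    (h : Alternates f k (Set.Ico a c)) :
    ∃ k₁ k₂, k = k₁ + k₂ ∧ Alternates f k₁ (Set.Ico a b) ∧ Alternates f k₂ (Set.Ico b c) := by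
  obtain ⟨x, ε, hε, hx, hlt, hs⟩ := h
  have hmono : ∀ j, j < k → ∀ i ≤ j, x i ≤ x j := by
    intro j
    induction j with
    | zero => intro _ i hi; rw [Nat.le_zero.1 hi]
    | succ j ih =>
      intro hj i hi
      rcases Nat.of_le_succ hi with h | h
      · exact (ih (by omega) i h).trans (hlt j hj).le
      · rw [h]
  classical
  have hex : ∃ q, q = k ∨ (q < k ∧ b ≤ x q) := ⟨k, Or.inl rfl⟩
  have hq := Nat.find_spec hex
  have hmin : ∀ i, i < Nat.find hex → i < k → x i < b := by
    intro i hi hik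
    have := Nat.find_min hex hi
    by_contra hb
    exact this (Or.inr ⟨hik, not_lt.1 hb⟩)
  set q := Nat.find hex
  have hqk : q ≤ k := by rcases hq with h | h <;> omega
  refine ⟨q, k - q, by omega, ⟨x, ε, hε, fun i hi => ⟨(hx i (by omega)).1, hmin i hi (by omega)⟩,
    fun i hi => hlt i (by omega), fun i hi => hs i (by omega)⟩,
    ⟨fun i => x (q + i), ε * (-1) ^ q, ?_, fun i hi => ?_, fun i hi => ?_, fun i hi => ?_⟩⟩
  · rcases hε with rfl | rfl <;> rcases neg_one_pow_eq_or ℝ q with h | h <;> rw [h] <;> norm_num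
  · have hq' : q < k := by omega
    rcases hq with h | h
    · omega
    · exact ⟨h.2.trans (hmono (q + i) (by omega) q (by omega)), (hx _ (by omega)).2⟩
  · exact hlt (q + i) (by omega)
  · have := hs (q + i) (by omega)
    rwa [pow_add, ← mul_assoc] at this

/-- The mean value inequality for right derivatives. One-sided derivatives are the right setting
because glued polynomials may have kinks at the knots. -/
theorem exists_right_deriv_pos {f f' : ℝ → ℝ} {a b s : ℝ} (hab : a ≤ b)
    (hf : ContinuousOn f (Set.Icc a b))
    (hf' : ∀ x ∈ Set.Ico a b, HasDerivWithinAt f (f' x) (Set.Ici x) x)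
    (h : 0 < s * (f b - f a)) : ∃ ξ ∈ Set.Ico a b, 0 < s * f' ξ := by
  by_contra! hcon
  have := image_le_of_deriv_right_le_deriv_boundary (f := fun x => s * f x)
    (f' := fun x => s * f' x) (a := a) (b := b) (hf.const_smul s)
    (fun x hx => (hf' x hx).const_mul s) (B := fun _ => s * f a) (B' := fun _ => 0)
    le_rfl continuousOn_const (fun x _ => hasDerivWithinAt_const ..) hcon
    (Set.right_mem_Icc.2 hab)
  linarith [mul_sub s (f b) (f a)]

/-- Rolle's theorem along a chain of points at which the increments of `f` alternate in sign. -/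
theorem alternates_deriv_of_increments {f f' : ℝ → ℝ} {k : ℕ} {a b : ℝ} {y : ℕ → ℝ} {ε : ℝ}
    (hε : ε = 1 ∨ ε = -1) (hya : a ≤ y 0) (hyb : y k ≤ b) (hy : ∀ i < k, y i ≤ y (i + 1))
    (hf : ContinuousOn f (Set.Icc a (y k)))
    (hf' : ∀ x ∈ Set.Ico a b, HasDerivWithinAt f (f' x) (Set.Ici x) x)
    (hs : ∀ i < k, 0 < ε * (-1) ^ i * (f (y (i + 1)) - f (y i))) :
    Alternates f' k (Set.Ico a b) := by
  have hlow : ∀ i ≤ k, a ≤ y i := by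
    intro i
    induction i with
    | zero => intro _; exact hya
    | succ i ih => intro hi; exact (ih (by omega)).trans (hy i (by omega))
  have hhigh : ∀ j ≤ k, y (k - j) ≤ y k := by
    intro j
    induction j with
    | zero => intro _; exact le_rfl
    | succ j ih =>
      intro hj
      have := hy (k - (j + 1)) (by omega)
      rw [show k - (j + 1) + 1 = k - j by omega] at this
      exact this.trans (ih (by omega))
  have hup : ∀ i ≤ k, y i ≤ y k := fun i hi => by
    have := hhigh (k - i) (by omega)
    rwa [show k - (k - i) = i by omega] at this
  have hex : ∀ i, ∃ ξ, i < k → ξ ∈ Set.Ico (y i) (y (i + 1)) ∧ 0 < ε * (-1) ^ i * f' ξ := by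
    intro i
    by_cases hi : i < k
    · obtain ⟨ξ, h1, h2⟩ := exists_right_deriv_pos (f := f) (f' := f') (hy i hi)
        (hf.mono (Set.Icc_subset_Icc (hlow i hi.le) (hup _ hi)))
        (fun x hx => hf' x ⟨(hlow i hi.le).trans hx.1, hx.2.trans_le ((hup _ hi).trans hyb)⟩)
        (hs i hi)
      exact ⟨ξ, fun _ => ⟨h1, h2⟩⟩
    · exact ⟨0, fun h => absurd h hi⟩
  choose ξ hξ using hex
  refine ⟨ξ, ε, hε, fun i hi => ⟨(hlow i hi.le).trans (hξ i hi).1.1,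
    (hξ i hi).1.2.trans_le ((hup _ hi).trans hyb)⟩, fun i hi => ?_, fun i hi => (hξ i hi).2⟩
  exact (hξ i (by omega)).1.2.trans_le (hξ (i + 1) hi).1.1

theorem pos_sub_of_alternating {ε u v : ℝ} {i : ℕ} (hu : 0 < ε * (-1) ^ i * u)
    (hv : 0 < ε * (-1) ^ (i + 1) * v) : 0 < -ε * (-1) ^ i * (v - u) := by
  rw [pow_succ] at hv
  nlinarith

theorem Alternates.deriv {f f' : ℝ → ℝ} {k : ℕ} {a b : ℝ}
    (hf : ContinuousOn f (Set.Ico a b))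
    (hf' : ∀ x ∈ Set.Ico a b, HasDerivWithinAt f (f' x) (Set.Ici x) x)
    (h : Alternates f (k + 1) (Set.Ico a b)) : Alternates f' k (Set.Ico a b) := by
  obtain ⟨x, ε, hε, hx, hlt, hs⟩ := h
  refine alternates_deriv_of_increments (f := f) (y := x) (ε := -ε) ?_ (hx 0 (by omega)).1
    (hx k (by omega)).2.le (fun i hi => (hlt i (by omega)).le)
    (hf.mono (Set.Icc_subset_Ico_right (hx k (by omega)).2)) hf' fun i hi =>
    pos_sub_of_alternating (hs i (by omega)) (hs (i + 1) (by omega))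
  rcases hε with rfl | rfl <;> norm_num

/-- The zero at `a` serves as an additional point before the chain, so Rolle's theorem loses
nothing. -/
theorem Alternates.deriv_of_left {f f' : ℝ → ℝ} {k : ℕ} {a b : ℝ}
    (hf : ContinuousOn f (Set.Ico a b))
    (hf' : ∀ x ∈ Set.Ico a b, HasDerivWithinAt f (f' x) (Set.Ici x) x) (ha : f a = 0)
    (h : Alternates f k (Set.Ico a b)) : Alternates f' k (Set.Ico a b) := by
  obtain ⟨x, ε, hε, hx, hlt, hs⟩ := h
  rcases Nat.eq_zero_or_pos k with rfl | hk
  · exact ⟨x, ε, hε, by simp, by simp, by simp⟩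
  obtain ⟨k, rfl⟩ : ∃ l, k = l + 1 := ⟨k - 1, by omega⟩
  let y : ℕ → ℝ := fun i => Nat.casesOn i a x
  refine alternates_deriv_of_increments (f := f) (y := y) (ε := ε) hε le_rfl
    (hx k (by omega)).2.le (fun i hi => ?_)
    (hf.mono (Set.Icc_subset_Ico_right (hx k (by omega)).2)) hf' fun i hi => ?_
  · cases i with
    | zero => exact (hx 0 (by omega)).1
    | succ i => exact (hlt i (by omega)).le
  · cases i with
    | zero => simpa [y, ha] using hs 0 (by omega)
    | succ i =>
      have := pos_sub_of_alternating (hs i (by omega)) (hs (i + 1) (by omega))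
      simp only [y]
      rw [pow_succ]
      linarith

/-- Zeros at both ends extend the chain on both sides, so Rolle's theorem gains one. An empty chain
gains nothing, hence `0 < k`. -/
theorem Alternates.deriv_of_left_right {f f' : ℝ → ℝ} {k : ℕ} {a b : ℝ} (hk : 0 < k)
    (hf : ContinuousOn f (Set.Icc a b))
    (hf' : ∀ x ∈ Set.Ico a b, HasDerivWithinAt f (f' x) (Set.Ici x) x) (ha : f a = 0)
    (hb : f b = 0)
    (h : Alternates f k (Set.Ico a b)) : Alternates f' (k + 1) (Set.Ico a b) := by
  obtain ⟨x, ε, hε, hx, hlt, hs⟩ := h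
  obtain ⟨k, rfl⟩ : ∃ l, k = l + 1 := ⟨k - 1, by omega⟩
  let y : ℕ → ℝ := fun i => Nat.casesOn i a fun j => if j < k + 1 then x j else b
  have hyk : y (k + 1 + 1) = b := by simp [y]
  refine alternates_deriv_of_increments (f := f) (y := y) (ε := ε) hε le_rfl
    hyk.le (fun i hi => ?_) (by rwa [hyk]) hf' fun i hi => ?_
  · cases i with
    | zero => simpa [y] using (hx 0 (by omega)).1
    | succ i =>
      simp only [y]
      rw [if_pos (show i < k + 1 by omega)]
      split_ifs with h1
      · exact (hlt i (by omega)).le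
      · exact (hx i (by omega)).2.le
  · cases i with
    | zero => simpa [y, ha] using hs 0 (by omega)
    | succ i =>
      simp only [y]
      rw [if_pos (show i < k + 1 by omega)]
      split_ifs with h1
      · have := pos_sub_of_alternating (hs i (by omega)) (hs (i + 1) (by omega))
        rw [pow_succ]
        linarith
      · have := hs i (by omega)
        rw [hb, pow_succ]
        linarith

theorem Alternates.le_of_degree_lt {p : ℝ[X]} {k w : ℕ} {a b : ℝ} (hp : p.degree < w)
    (h : Alternates (fun t => p.eval t) k (Set.Ico a b)) : k ≤ w := by
  induction w generalizing p k with
  | zero =>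
    have hp0 : p = 0 := by
      rw [← degree_eq_bot]
      exact Nat.WithBot.lt_zero_iff.1 (by simpa using hp)
    by_contra hk
    obtain ⟨x, ε, hε, hx, hlt, hs⟩ := h
    simpa [hp0] using hs 0 (by omega)
  | succ w ih =>
    rcases k with _ | k
    · omega
    have hd : (derivative p).degree < w := by
      rcases eq_or_ne p 0 with rfl | hp0
      · simp
      by_cases hd0 : derivative p = 0
      · simp [hd0]
      · have h1 := degree_derivative_lt hp0
        rw [degree_eq_natDegree hp0] at h1 hp
        rw [degree_eq_natDegree hd0] at h1 ⊢
        norm_cast at *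
        omega
    have := ih hd (h.deriv (f' := fun t => (derivative p).eval t) p.continuous.continuousOn
      fun x _ => (p.hasDerivAt x).hasDerivWithinAt)
    omega

/-! ### Antiderivatives of polynomials -/

/-- The antiderivative of a polynomial vanishing at `0`. -/
def integ (p : ℝ[X]) : ℝ[X] := ∑ i ∈ Finset.range (p.natDegree + 1),
  C (p.coeff i / ((i : ℝ) + 1)) * X ^ (i + 1)

@[simp] theorem derivative_integ (p : ℝ[X]) : derivative (integ p) = p := by
  conv_rhs => rw [p.as_sum_range_C_mul_X_pow]
  rw [integ, derivative_sum]
  refine Finset.sum_congr rfl fun i _ => ?_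
  rw [derivative_C_mul_X_pow]
  have : ((i : ℝ) + 1) ≠ 0 := by positivity
  simp only [Nat.cast_add, Nat.cast_one, Nat.add_sub_cancel]
  rw [div_mul_cancel₀ _ this]

@[simp] theorem eval_zero_integ (p : ℝ[X]) : (integ p).eval 0 = 0 := by
  simp [integ, eval_finsetSum]

theorem natDegree_integ_le {p : ℝ[X]} {k : ℕ} (hp : p.natDegree ≤ k) :
    (integ p).natDegree ≤ k + 1 := by
  refine natDegree_sum_le_of_forall_le _ _ fun i hi => ?_
  refine (natDegree_C_mul_X_pow_le _ _).trans ?_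
  have := Finset.mem_range.1 hi
  omega

theorem integral_eval_derivative (p : ℝ[X]) (a b : ℝ) :
    ∫ t in a..b, (derivative p).eval t = p.eval b - p.eval a :=
  intervalIntegral.integral_eq_sub_of_hasDerivAt (fun x _ => p.hasDerivAt x)
    ((derivative p).continuous.intervalIntegrable _ _)

theorem integral_mul_derivative_add (p q : ℝ[X]) (h : ℝ) :
    (∫ t in (0 : ℝ)..h, p.eval t * (derivative q).eval t) +
      ∫ t in (0 : ℝ)..h, (derivative p).eval t * q.eval t
      = p.eval h * q.eval h - p.eval 0 * q.eval 0 := by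
  have hadd := intervalIntegral.integral_add (μ := volume)
    ((p.continuous.mul (derivative q).continuous).intervalIntegrable 0 h)
    (((derivative p).continuous.mul q.continuous).intervalIntegrable 0 h)
  simp only [Pi.mul_apply] at hadd
  rw [← hadd]
  have := integral_eval_derivative (p * q) 0 h
  rw [derivative_mul] at this
  simp only [eval_add, eval_mul] at this
  rw [← this]
  exact intervalIntegral.integral_congr fun t _ => by ring

/-- A nonzero polynomial orthogonal to all polynomials of degree `< k` has `k + 1` alternations. -/
theorem alternates_of_orthogonal {h : ℝ} (hh : 0 < h) {p : ℝ[X]} (hp : p ≠ 0) {k : ℕ}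
    (ho : ∀ q : ℝ[X], q.natDegree < k → ∫ t in (0 : ℝ)..h, p.eval t * q.eval t = 0) :
    Alternates (fun t => p.eval t) (k + 1) (Set.Ico 0 h) := by
  induction k generalizing p with
  | zero =>
    have : ∃ t ∈ Set.Ico 0 h, p.eval t ≠ 0 := by
      by_contra! hcon
      exact hp (p.eq_zero_of_infinite_isRoot
        ((Set.Ico_infinite hh).mono fun t ht => hcon t ht))
    obtain ⟨t, ht, hpt⟩ := this
    rcases lt_or_gt_of_ne hpt with h1 | h1
    · exact ⟨fun _ => t, -1, Or.inr rfl, fun _ _ => ht, fun i hi => by omega, fun i hi => by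
        obtain rfl : i = 0 := by omega
        simpa using h1⟩
    · exact ⟨fun _ => t, 1, Or.inl rfl, fun _ _ => ht, fun i hi => by omega, fun i hi => by
        obtain rfl : i = 0 := by omega
        simpa using h1⟩
  | succ k ih =>
    -- Testing against 1 makes the antiderivative vanish at both ends. It inherits orthogonality in
    -- one degree less, and Rolle's theorem returns the missing alternation.
    have hend : (integ p).eval h = 0 := by
      have h1 := ho 1 (by simp)
      have h2 := integral_eval_derivative (integ p) 0 h
      simp only [derivative_integ, eval_zero_integ, sub_zero, eval_one, mul_one] at h1 h2
      rw [← h2, h1]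
    have h0 : integ p ≠ 0 := fun h0 => hp (by rw [← derivative_integ p, h0, derivative_zero])
    have h1 := ih h0 fun q hq => by
      have h2 := integral_mul_derivative_add (integ p) (integ q) h
      rw [hend, eval_zero_integ, derivative_integ, derivative_integ,
        ho (integ q) (lt_of_le_of_lt (natDegree_integ_le (k := q.natDegree) le_rfl) (by omega))]
        at h2
      simpa using h2
    exact h1.deriv_of_left_right (by omega) (integ p).continuous.continuousOn
      (fun x _ => by simpa using ((integ p).hasDerivAt x).hasDerivWithinAt)
      (eval_zero_integ p) hend

/-! ### Piecewise polynomial functions -/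

/-- The function on `[0, ∞)` that is the `i`-th polynomial, in the local coordinate `x - i h`,
on `[i h, (i + 1) h)`. -/
def glue (h : ℝ) (P : ℕ → ℝ[X]) (x : ℝ) : ℝ :=
  (P ⌊x / h⌋₊).eval (x - ⌊x / h⌋₊ * h)

theorem glue_add {h : ℝ} (P : ℕ → ℝ[X]) (i : ℕ) {t : ℝ} (ht : t ∈ Set.Ico 0 h) :
    glue h P (i * h + t) = (P i).eval t := by
  have hh : 0 < h := ht.1.trans_lt ht.2
  have hfl : ⌊(i * h + t) / h⌋₊ = i := by
    rw [Nat.floor_eq_iff (by have := ht.1; positivity)]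
    constructor
    · rw [le_div_iff₀ hh]
      linarith [ht.1]
    · rw [div_lt_iff₀ hh]
      linarith [ht.2]
  rw [glue, hfl]
  congr 1
  ring

theorem exists_piece {h : ℝ} (hh : 0 < h) {x : ℝ} (hx : 0 ≤ x) :
    ∃ i : ℕ, ∃ t ∈ Set.Ico 0 h, x = i * h + t := by
  refine ⟨⌊x / h⌋₊, x - ⌊x / h⌋₊ * h, ⟨?_, ?_⟩, by ring⟩
  · have := Nat.floor_le (show 0 ≤ x / h by positivity)
    rw [le_div_iff₀ hh] at this
    linarith
  · have := Nat.lt_floor_add_one (x / h)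
    rw [div_lt_iff₀ hh] at this
    linarith

theorem lt_of_piece_lt {h : ℝ} {i b : ℕ} {t : ℝ} (ht : t ∈ Set.Ico 0 h)
    (hx : i * h + t < b * h) : i < b := by
  have hh : 0 < h := ht.1.trans_lt ht.2
  have : (i : ℝ) < b := by
    have h1 : (i : ℝ) * h < b * h := by linarith [ht.1]
    exact lt_of_mul_lt_mul_right h1 hh.le
  exact_mod_cast this

theorem glue_congr {h : ℝ} (hh : 0 < h) {P Q : ℕ → ℝ[X]} {b : ℕ} (hPQ : ∀ i < b, P i = Q i)
    {x : ℝ} (hx : x ∈ Set.Ico 0 (b * h)) : glue h P x = glue h Q x := by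
  obtain ⟨i, t, ht, rfl⟩ := exists_piece hh hx.1
  rw [glue_add P i ht, glue_add Q i ht, hPQ i (lt_of_piece_lt ht hx.2)]

/-- To the right of a knot only the right-hand piece matters, so no matching condition is needed for
a right derivative. -/
theorem hasDerivWithinAt_glue {h : ℝ} (hh : 0 < h) (P : ℕ → ℝ[X]) {x : ℝ} (hx : 0 ≤ x) :
    HasDerivWithinAt (glue h P) (glue h (fun i => derivative (P i)) x) (Set.Ici x) x := by
  obtain ⟨i, t, ht, rfl⟩ := exists_piece hh hx
  rw [glue_add _ i ht]
  have h1 : HasDerivAt (fun y => (P i).eval (y - i * h)) ((derivative (P i)).eval t)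
      (i * h + t) := by
    have := (P i).hasDerivAt (i * h + t - i * h)
    rw [show (i * h + t - i * h : ℝ) = t by ring] at this
    simpa using HasDerivAt.comp_sub_const (i * h + t) (i * h)
      (by rwa [show (i * h + t - i * h : ℝ) = t by ring])
  refine h1.hasDerivWithinAt.congr_of_eventuallyEq ?_ ?_
  · have : Set.Ico (i * h + t) (i * h + h) ∈ nhdsWithin (i * h + t) (Set.Ici (i * h + t)) :=
      Ico_mem_nhdsGE (by linarith [ht.2])
    filter_upwards [this] with y hy
    have := glue_add P i (t := y - i * h) (h := h)
      ⟨by linarith [hy.1, ht.1], by linarith [hy.2]⟩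
    rwa [show i * h + (y - i * h) = y by ring] at this
  · rw [glue_add _ i ht]
    congr 1
    ring

theorem continuousOn_glue_Icc {h : ℝ} (hh : 0 < h) (P : ℕ → ℝ[X]) (b : ℕ)
    (hP : ∀ i < b, (P i).eval h = (P (i + 1)).eval 0) :
    ContinuousOn (glue h P) (Set.Icc 0 (b * h)) := by
  induction b with
  | zero => simp
  | succ b ih =>
    have h1 : ContinuousOn (glue h P) (Set.Icc (b * h) ((b + 1 : ℕ) * h)) := by
      refine ContinuousOn.congr (f := fun y => (P b).eval (y - b * h)) (by fun_prop) ?_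
      intro y hy
      rcases eq_or_lt_of_le hy.2 with h2 | h2
      · have := glue_add P (b + 1) (t := 0) ⟨le_rfl, hh⟩
        rw [add_zero] at this
        simp only
        rw [h2, this, ← hP b (by omega)]
        congr 1
        push_cast
        ring
      · push_cast at h2
        have := glue_add P b (t := y - b * h) (h := h) ⟨by linarith [hy.1], by linarith⟩
        rwa [show b * h + (y - b * h) = y by ring] at this
    have h2 := (ih fun i hi => hP i (by omega)).union_of_isClosed h1 isClosed_Icc isClosed_Icc
    rwa [Set.Icc_union_Icc_eq_Icc (by positivity)
      (by push_cast; nlinarith)] at h2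

theorem continuousOn_glue_Ico {h : ℝ} (hh : 0 < h) (P : ℕ → ℝ[X]) (b : ℕ)
    (hP : ∀ i, i + 1 < b → (P i).eval h = (P (i + 1)).eval 0) :
    ContinuousOn (glue h P) (Set.Ico 0 (b * h)) := by
  -- The value at the excluded end `b * h` is irrelevant; a constant tail makes the function
  -- continuous up to it.
  let Q : ℕ → ℝ[X] := fun i => if i < b then P i else C ((P (b - 1)).eval h)
  have hQ : ContinuousOn (glue h Q) (Set.Icc 0 (b * h)) := by
    refine continuousOn_glue_Icc hh Q b fun i hi => ?_
    simp only [Q]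
    rw [if_pos hi]
    split_ifs with h1
    · exact hP i h1
    · rw [eval_C, show b - 1 = i by omega]
  refine (hQ.mono Set.Ico_subset_Icc_self).congr fun x hx => glue_congr hh (fun i hi => ?_) hx
  simp [Q, hi]

theorem alternates_glue {h : ℝ} (hh : 0 < h) (P : ℕ → ℝ[X]) (c : ℕ → ℕ) (b : ℕ)
    (hP : ∀ i ≤ b, Alternates (fun t => (P i).eval t) (c i + 1) (Set.Ico 0 h)) :
    Alternates (glue h P) (∑ i ∈ Finset.range (b + 1), c i + 1)
      (Set.Ico 0 ((b + 1 : ℕ) * h)) := by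
  have hpiece : ∀ i ≤ b, Alternates (glue h P) (c i + 1) (Set.Ico (i * h) ((i + 1 : ℕ) * h)) := by
    intro i hi
    have h1 : Alternates (fun t => glue h P (i * h + t)) (c i + 1) (Set.Ico 0 h) :=
      (hP i hi).congr fun t ht => (glue_add P i ht).symm
    have h2 := h1.comp_add
    rwa [add_zero, show (i * h + h : ℝ) = (i + 1 : ℕ) * h by push_cast; ring] at h2
  induction b with
  | zero => simpa using hpiece 0 le_rfl
  | succ b ih =>
    rw [Finset.sum_range_succ]
    exact (ih (fun i hi => hP i (by omega)) (fun i hi => hpiece i (by omega))).append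
      (by positivity) (by push_cast; nlinarith) (hpiece (b + 1) le_rfl)

/-- The bound adds up over half-open pieces without any continuity, so it applies to the derivative
of order `2r + 1`, which may jump at knots. -/
theorem Alternates.le_sum_of_glue {h : ℝ} {P : ℕ → ℝ[X]} {w : ℕ → ℕ} {b k : ℕ}
    (hP : ∀ i < b, (P i).degree < w i)
    (hk : Alternates (glue h P) k (Set.Ico 0 (b * h))) : k ≤ ∑ i ∈ Finset.range b, w i := by
  induction b generalizing k with
  | zero =>
    by_contra hcon
    obtain ⟨x, ε, hε, hx, hlt, hs⟩ := hk
    simpa using hx 0 (by simpa [Nat.pos_iff_ne_zero] using hcon)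
  | succ b ih =>
    obtain ⟨k₁, k₂, rfl, h₁, h₂⟩ := hk.split (b := b * h)
    rw [Finset.sum_range_succ]
    refine add_le_add (ih (fun i hi => hP i (by omega)) h₁) ?_
    rw [show ((b + 1 : ℕ) * h : ℝ) = b * h + h by push_cast; ring] at h₂
    have h₃ := (Alternates.sub_comp (c := b * h) (a := 0) (b := h) (by rwa [add_zero])).congr
      fun t ht => glue_add P b ht
    exact h₃.le_of_degree_lt (hP b (by omega))

theorem iterate_derivative_degree_lt {p : ℝ[X]} {k w : ℕ} (hp : p.degree < (w + k : ℕ)) :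
    (derivative^[k] p).degree < w := by
  induction k generalizing p with
  | zero => simpa using hp
  | succ k ih =>
    rw [Function.iterate_succ_apply]
    apply ih
    rcases eq_or_ne p 0 with rfl | hp0
    · rw [derivative_zero, degree_zero]
      exact WithBot.bot_lt_coe _
    by_cases hd0 : derivative p = 0
    · rw [hd0, degree_zero]
      exact WithBot.bot_lt_coe _
    · have h1 := degree_derivative_lt hp0
      rw [degree_eq_natDegree hp0] at h1 hp
      rw [degree_eq_natDegree hd0] at h1 ⊢
      norm_cast at *
      omega

/-- A piecewise polynomial of class `C^{2r}` that vanishes to order `r + 1` at the left end and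
to order `r` at the right end cannot consist of nonzero pieces of degree at most `m i + r`
that are orthogonal to the polynomials of degree less than `m i - r`. -/
theorem false_of_orthogonal_pieces {h : ℝ} (hh : 0 < h) {r b : ℕ} {m : ℕ → ℕ} {P : ℕ → ℝ[X]}
    (hm : ∀ i ≤ b, r ≤ m i) (hP0 : ∀ i ≤ b, P i ≠ 0)
    (hdeg : ∀ i ≤ b, (P i).natDegree ≤ m i + r)
    (ho : ∀ i ≤ b, ∀ q : ℝ[X], q.natDegree < m i - r →
      ∫ t in (0 : ℝ)..h, (P i).eval t * q.eval t = 0)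
    (hjoin : ∀ i < b, ∀ s ≤ 2 * r,
      (derivative^[s] (P i)).eval h = (derivative^[s] (P (i + 1))).eval 0)
    (hleft : ∀ s ≤ r, (derivative^[s] (P 0)).eval 0 = 0)
    (hright : ∀ s < r, (derivative^[s] (P b)).eval h = 0) : False := by
  -- `glue` reads the next piece at a knot. A zero tail therefore makes every derivative vanish at
  -- the right end, and `hright` makes those of order `< r` continuous there.
  let Q : ℕ → ℝ[X] := fun i => if i ≤ b then P i else 0
  have hQ : ∀ i ≤ b, Q i = P i := fun i hi => by simp [Q, hi]
  let f : ℕ → ℝ → ℝ := fun s => glue h fun i => derivative^[s] (Q i)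
  have hf' : ∀ s, ∀ x ∈ Set.Ico (0 : ℝ) ((b + 1 : ℕ) * h),
      HasDerivWithinAt (f s) (f (s + 1) x) (Set.Ici x) x := by
    intro s x hx
    simpa only [f, Function.iterate_succ_apply'] using
      hasDerivWithinAt_glue hh (fun i => derivative^[s] (Q i)) hx.1
  have hstart : ∀ s ≤ r, f s 0 = 0 := by
    intro s hs
    have := glue_add (fun i => derivative^[s] (Q i)) 0 (t := 0) ⟨le_rfl, hh⟩
    simp only [Nat.cast_zero, zero_mul, add_zero] at this
    simp only [f]
    rw [this, hQ 0 (by omega), hleft s hs]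
  have hend : ∀ s, f s ((b + 1 : ℕ) * h) = 0 := by
    intro s
    have := glue_add (fun i => derivative^[s] (Q i)) (b + 1) (t := 0) ⟨le_rfl, hh⟩
    rw [add_zero] at this
    simp only [f]
    rw [this]
    simp [Q]
  have hcIcc : ∀ s < r, ContinuousOn (f s) (Set.Icc 0 ((b + 1 : ℕ) * h)) := by
    intro s hs
    refine continuousOn_glue_Icc hh _ _ fun i hi => ?_
    rcases Nat.lt_or_ge i b with h1 | h1
    · rw [hQ i h1.le, hQ (i + 1) h1]
      exact hjoin i h1 s (by omega)
    · obtain rfl : i = b := by omega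
      rw [hQ i le_rfl, hright s hs]
      simp [Q]
  have hcIco : ∀ s ≤ 2 * r, ContinuousOn (f s) (Set.Ico 0 ((b + 1 : ℕ) * h)) := by
    intro s hs
    refine continuousOn_glue_Ico hh _ _ fun i hi => ?_
    rw [hQ i (by omega), hQ (i + 1) (by omega)]
    exact hjoin i (by omega) s hs
  set K := ∑ i ∈ Finset.range (b + 1), (m i - r)
  have h0 : Alternates (f 0) (K + 1) (Set.Ico 0 ((b + 1 : ℕ) * h)) := by
    refine alternates_glue hh _ (fun i => m i - r) b fun i hi => ?_
    simp only [Function.iterate_zero, id]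
    rw [hQ i hi]
    exact alternates_of_orthogonal hh (hP0 i hi) (ho i hi)
  -- The first `r` differentiations have zeros at both ends and gain one alternation each.
  have h1 : ∀ s ≤ r, Alternates (f s) (K + 1 + s) (Set.Ico 0 ((b + 1 : ℕ) * h)) := by
    intro s
    induction s with
    | zero => intro _; exact h0
    | succ s ih =>
      intro hs
      exact (ih (by omega)).deriv_of_left_right (Nat.succ_pos _ |>.trans_le (by omega :
        1 ≤ K + 1 + s)) (hcIcc s hs) (hf' s)
        (hstart s (by omega)) (hend s)
  -- The derivative of order `r` has a guaranteed zero at the left end but need not be continuous at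
  -- the right end, so the count is only kept.
  have h2 := (h1 r le_rfl).deriv_of_left (hcIco r (by omega)) (hf' r) (hstart r le_rfl)
  -- The remaining `r` differentiations lose one each, which leaves `K + 1` alternations at order
  -- `2r + 1`.
  have h3 : ∀ s ≤ r, Alternates (f (r + 1 + s)) (K + 1 + r - s)
      (Set.Ico 0 ((b + 1 : ℕ) * h)) := by
    intro s
    induction s with
    | zero => intro _; exact h2
    | succ s ih =>
      intro hs
      refine Alternates.deriv (hcIco (r + 1 + s) (by omega)) (hf' (r + 1 + s)) ?_
      rw [show K + 1 + r - (s + 1) + 1 = K + 1 + r - s by omega]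
      exact ih (by omega)
  have h4 := (h3 r le_rfl).le_sum_of_glue (w := fun i => m i - r) fun i hi => by
    rw [hQ i (by omega)]
    refine iterate_derivative_degree_lt ?_
    have := hm i (by omega)
    have h5 := hdeg i (by omega)
    exact (degree_le_of_natDegree_le h5).trans_lt (by exact_mod_cast (by omega))
  omega

/-! ### Integration by parts for piecewise polynomials -/

/-- The continuous piecewise antiderivative, vanishing at `0`. -/
def primitive (h : ℝ) (P : ℕ → ℝ[X]) (i : ℕ) : ℝ[X] :=
  integ (P i) + C (∑ j ∈ Finset.range i, (integ (P j)).eval h)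

@[simp] theorem derivative_primitive (h : ℝ) (P : ℕ → ℝ[X]) (i : ℕ) :
    derivative (primitive h P i) = P i := by
  simp [primitive]

theorem eval_zero_primitive_zero (h : ℝ) (P : ℕ → ℝ[X]) : (primitive h P 0).eval 0 = 0 := by
  simp [primitive]

theorem eval_primitive_succ (h : ℝ) (P : ℕ → ℝ[X]) (i : ℕ) :
    (primitive h P i).eval h = (primitive h P (i + 1)).eval 0 := by
  simp only [primitive, Finset.sum_range_succ, eval_add, eval_C, eval_zero_integ]
  ring

theorem natDegree_primitive_le {h : ℝ} {P : ℕ → ℝ[X]} {i k : ℕ} (hP : (P i).natDegree ≤ k) :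
    (primitive h P i).natDegree ≤ k + 1 :=
  (natDegree_add_le _ _).trans (max_le (natDegree_integ_le hP) ((natDegree_C _).trans_le (by omega)))

/-- For a zero piece the primitive is just the constant carried over, which covers `k = 0`. -/
theorem natDegree_primitive_le_of_degree_lt {h : ℝ} {P : ℕ → ℝ[X]} {i k : ℕ}
    (hP : (P i).degree < k) : (primitive h P i).natDegree ≤ k := by
  by_cases h0 : P i = 0
  · rw [primitive, h0, show integ 0 = 0 by simp [integ], zero_add, natDegree_C]
    exact Nat.zero_le k
  · exact (natDegree_primitive_le le_rfl).trans ((natDegree_lt_iff_degree_lt h0).2 hP)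

theorem sum_integral_by_parts {h : ℝ} {A B : ℕ → ℝ[X]} {b : ℕ}
    (hA : ∀ i < b, (A i).eval h = (A (i + 1)).eval 0)
    (hB : ∀ i < b, (B i).eval h = (B (i + 1)).eval 0) :
    (∑ i ∈ Finset.range (b + 1), ∫ t in (0 : ℝ)..h, (A i).eval t * (derivative (B i)).eval t) +
      ∑ i ∈ Finset.range (b + 1), ∫ t in (0 : ℝ)..h, (derivative (A i)).eval t * (B i).eval t
      = (A b).eval h * (B b).eval h - (A 0).eval 0 * (B 0).eval 0 := by
  rw [← Finset.sum_add_distrib]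
  simp_rw [integral_mul_derivative_add]
  induction b with
  | zero => simp
  | succ b ih =>
    rw [Finset.sum_range_succ, ih (fun i hi => hA i (by omega)) (fun i hi => hB i (by omega)),
      hA b (by omega), hB b (by omega)]
    ring

/-- Orthogonality, over the pieces `0, …, b`, to the piecewise polynomials of degrees `< e i`
and of class `C^{k-1}`. -/
def OrthToSplines (h : ℝ) (b k : ℕ) (e : ℕ → ℕ) (F : ℕ → ℝ[X]) : Prop :=
  ∀ g : ℕ → ℝ[X], (∀ i ≤ b, (g i).degree < e i) →
    (∀ i < b, ∀ s < k, (derivative^[s] (g i)).eval h = (derivative^[s] (g (i + 1))).eval 0) →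
    ∑ i ∈ Finset.range (b + 1), ∫ t in (0 : ℝ)..h, (F i).eval t * (g i).eval t = 0

/-- The constant 1 is an admissible test, so the primitive vanishes at the right end. Integration by
parts against the primitive of `g`, one class smoother and one degree higher, then has no boundary
terms. -/
theorem OrthToSplines.primitive_step {h : ℝ} {b k : ℕ} {e : ℕ → ℕ} {F : ℕ → ℝ[X]}
    (he : ∀ i ≤ b, 1 ≤ e i) (hF : OrthToSplines h b (k + 1) e F) :
    (primitive h F b).eval h = 0 ∧
      OrthToSplines h b k (fun i => e i - 1) (primitive h F) := by
  have hend : (primitive h F b).eval h = 0 := by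
    have h1 := hF (fun _ => 1) (fun i hi => by
      rw [degree_one]
      exact_mod_cast he i hi) (fun i _ s _ => by cases s <;> simp)
    have h2 := sum_integral_by_parts (h := h) (A := primitive h F) (B := fun _ => 1) (b := b)
      (fun i _ => eval_primitive_succ h F i) (by simp)
    simp only [derivative_primitive, h1, eval_zero_primitive_zero] at h2
    simpa using h2.symm
  refine ⟨hend, fun g hg hj => ?_⟩
  have h1 := hF (primitive h g) (fun i hi => ?_) (fun i hi s hs => ?_)
  · have h2 := sum_integral_by_parts (h := h) (A := primitive h F) (B := primitive h g) (b := b)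
      (fun i _ => eval_primitive_succ h F i) (fun i _ => eval_primitive_succ h g i)
    simp only [derivative_primitive, h1, eval_zero_primitive_zero, hend] at h2
    simpa using h2
  · have h3 := he i hi
    refine (degree_le_of_natDegree_le (natDegree_primitive_le_of_degree_lt (hg i hi))).trans_lt ?_
    exact_mod_cast Nat.sub_lt h3 one_pos
  · cases s with
    | zero => exact eval_primitive_succ h g i
    | succ s =>
      simp only [Function.iterate_succ_apply, derivative_primitive]
      exact hj i hi s (by omega)

/-- Each primitive trades one order of smoothness of the test functions for one degree. After `k`
steps the pieces of a test function are independent, and orthogonality becomes local. -/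
theorem OrthToSplines.exists_iterated_primitive {h : ℝ} {b k : ℕ} {e w : ℕ → ℕ}
    {F : ℕ → ℝ[X]} (he : ∀ i ≤ b, k ≤ e i) (hw : ∀ i ≤ b, (F i).natDegree ≤ w i)
    (hF : OrthToSplines h b k e F) :
    ∃ H : ℕ → ℝ[X], (∀ i, derivative^[k] (H i) = F i) ∧
      (∀ i, ∀ s < k, (derivative^[s] (H i)).eval h = (derivative^[s] (H (i + 1))).eval 0) ∧
      (∀ s < k, (derivative^[s] (H 0)).eval 0 = 0) ∧
      (∀ s < k, (derivative^[s] (H b)).eval h = 0) ∧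
      (∀ i ≤ b, (H i).natDegree ≤ w i + k) ∧
      ∀ i ≤ b, ∀ q : ℝ[X], q.natDegree < e i - k →
        ∫ t in (0 : ℝ)..h, (H i).eval t * q.eval t = 0 := by
  induction k generalizing F e w with
  | zero =>
    refine ⟨F, fun _ => rfl, by simp, by simp, by simp, hw, fun i hi q hq => ?_⟩
    -- With no joining conditions left, a test family may be supported on one piece.
    have h1 := hF (fun j => if j = i then q else 0) (fun j hj => ?_) (by simp)
    · rw [Finset.sum_eq_single i] at h1
      · simpa using h1
      · intro j _ hj
        simp [hj]
      · simp
        omega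
    · split_ifs with h2
      · rw [h2]
        exact degree_le_natDegree.trans_lt (by exact_mod_cast hq)
      · rw [degree_zero]
        exact WithBot.bot_lt_coe _
  | succ k ih =>
    obtain ⟨hend, ho⟩ := hF.primitive_step fun i hi => (by have := he i hi; omega : 1 ≤ e i)
    obtain ⟨H, h1, h2, h3, h4, h5, h6⟩ := ih (w := fun i => w i + 1)
      (fun i hi => by have := he i hi; omega)
      (fun i hi => natDegree_primitive_le (hw i hi)) ho
    refine ⟨H, fun i => ?_, fun i s hs => ?_, fun s hs => ?_, fun s hs => ?_, fun i hi => ?_,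
      fun i hi q hq => h6 i hi q (by omega)⟩
    · rw [Function.iterate_succ_apply', h1, derivative_primitive]
    · rcases Nat.lt_succ_iff_lt_or_eq.1 hs with h | rfl
      · exact h2 i s h
      · rw [h1, h1, eval_primitive_succ]
    · rcases Nat.lt_succ_iff_lt_or_eq.1 hs with h | rfl
      · exact h3 s h
      · rw [h1, eval_zero_primitive_zero]
    · rcases Nat.lt_succ_iff_lt_or_eq.1 hs with h | rfl
      · exact h4 s h
      · rw [h1, hend]
    · have := h5 i hi
      omega

/-- A spline of regularity `r` vanishing at `0` that is orthogonal to the derivatives of all such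
splines vanishes. -/
theorem eq_zero_of_orthToSplines {h : ℝ} (hh : 0 < h) {r b : ℕ} {m : ℕ → ℕ} {F : ℕ → ℝ[X]}
    (hm : ∀ i ≤ b, r ≤ m i) (hdeg : ∀ i ≤ b, (F i).natDegree ≤ m i)
    (hjoin : ∀ i < b, ∀ s ≤ r,
      (derivative^[s] (F i)).eval h = (derivative^[s] (F (i + 1))).eval 0)
    (h0 : (F 0).eval 0 = 0) (ho : OrthToSplines h b r m F) : ∀ i ≤ b, F i = 0 := by
  obtain ⟨H, h1, h2, h3, h4, h5, h6⟩ := ho.exists_iterated_primitive hm hdeg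
  -- Orders below `r` match by construction of the primitives; orders `r` to `2r` are those of `F`
  -- itself.
  have hj : ∀ i < b, ∀ s ≤ 2 * r,
      (derivative^[s] (H i)).eval h = (derivative^[s] (H (i + 1))).eval 0 := by
    intro i hi s hs
    rcases Nat.lt_or_ge s r with h | h
    · exact h2 i s h
    · have := hjoin i hi (s - r) (by omega)
      rwa [← h1, ← h1, ← Function.iterate_add_apply, ← Function.iterate_add_apply,
        show s - r + r = s by omega] at this
  by_contra! hne
  -- The pieces `a, …, c` will be the first maximal run of nonzero pieces of `H`.
  have hex : ∃ i, i ≤ b ∧ H i ≠ 0 := by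
    obtain ⟨i, hi, hFi⟩ := hne
    refine ⟨i, hi, fun hH => hFi ?_⟩
    rw [← h1, hH, iterate_derivative_zero]
  classical
  have ha := Nat.find_spec hex
  have ha' := fun i (hi : i < Nat.find hex) => Nat.find_min hex hi
  set a := Nat.find hex
  have hex' : ∃ c, a ≤ c ∧ (c = b ∨ H (c + 1) = 0) := ⟨b, ha.1, Or.inl rfl⟩
  have hc := Nat.find_spec hex'
  have hc' := fun i (hi : i < Nat.find hex') => Nat.find_min hex' hi
  have hcb : Nat.find hex' ≤ b := Nat.find_min' hex' ⟨ha.1, Or.inl rfl⟩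
  set c := Nat.find hex'
  refine false_of_orthogonal_pieces hh (r := r) (b := c - a) (m := fun i => m (a + i))
    (P := fun i => H (a + i)) (fun i hi => hm _ (by omega)) (fun i hi => ?_)
    (fun i hi => h5 _ (by omega)) (fun i hi => h6 _ (by omega))
    (fun i hi s hs => hj (a + i) (by omega) s hs) (fun s hs => ?_) (fun s hs => ?_)
  · cases i with
    | zero => exact ha.2
    | succ i =>
      intro h7
      exact hc' (a + i) (by omega) ⟨by omega, Or.inr h7⟩
  · simp only [add_zero]
    -- The zero of order `r + 1` at the left end comes from `F(0) = 0` if the run starts at the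
    -- origin, and otherwise from the preceding zero piece.
    rcases Nat.eq_zero_or_pos a with h7 | h7
    · rw [h7]
      rcases Nat.lt_or_ge s r with h | h
      · exact h3 s h
      · rw [show s = r by omega, h1, h0]
    · have h8 : H (a - 1) = 0 := by
        by_contra h9
        exact ha' (a - 1) (by omega) ⟨by omega, h9⟩
      have h9 := hj (a - 1) (by omega) s (by omega)
      rw [h8, show a - 1 + 1 = a by omega] at h9
      rw [← h9]
      simp
  · rw [show a + (c - a) = c by omega]
    rcases Nat.lt_or_ge c b with h7 | h7
    · have h8 : H (c + 1) = 0 := hc.2.resolve_left (by omega)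
      rw [hj c h7 s (by omega), h8]
      simp
    · rw [show c = b by omega]
      exact h4 s hs

/-! ### Krull dimension of finitely generated algebras -/

/-- Incomparability gives one inequality; lying over and going up give the other. -/
theorem ringKrullDim_eq_of_isIntegral {R S : Type*} [CommRing R] [CommRing S] [Algebra R S]
    [IsDomain S] [Algebra.IsIntegral R S] (hinj : Function.Injective (algebraMap R S)) :
    ringKrullDim S = ringKrullDim R := by
  refine le_antisymm ?_ ?_
  · exact Order.krullDim_le_of_strictMono (PrimeSpectrum.comap (algebraMap R S))
      fun P Q hPQ => Ideal.IsIntegral.comap_lt_comap (I := P.asIdeal) (J := Q.asIdeal) hPQ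
  · refine iSup_le fun l => ?_
    have hker : RingHom.ker (algebraMap R S) ≤ l.head.asIdeal := by
      rw [(RingHom.injective_iff_ker_eq_bot _).1 hinj]
      exact bot_le
    obtain ⟨P, hP, hPl⟩ := Ideal.exists_ideal_over_prime_of_isIntegral_of_isDomain l.head.asIdeal hker
    have : P.LiesOver l.head.asIdeal := ⟨hPl.symm⟩
    obtain ⟨M, hM, -⟩ := Ideal.exists_ltSeries_of_hasGoingUp (S := S) l P
    rw [← hM]
    exact Order.LTSeries.length_le_krullDim M

theorem ringKrullDim_mvPolynomial_fin (k : Type*) [Field k] (s : ℕ) :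
    ringKrullDim (MvPolynomial (Fin s) k) = s := by
  simp

/-- The Krull dimension of a finitely generated domain over a field is its transcendence degree. -/
theorem ringKrullDim_eq_trdeg (k R : Type) [Field k] [CommRing R] [IsDomain R] [Algebra k R]
    [Algebra.FiniteType k R] :
    ∃ s : ℕ, ringKrullDim R = s ∧ Algebra.trdeg k R = s := by
  -- Noether normalisation: an integral extension preserves both the Krull dimension and the
  -- transcendence degree.
  obtain ⟨s, g, hg, hint⟩ := exists_integral_inj_algHom_of_fg k R
  refine ⟨s, ?_, ?_⟩
  · let _ : Algebra (MvPolynomial (Fin s) k) R := g.toRingHom.toAlgebra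
    have : Algebra.IsIntegral (MvPolynomial (Fin s) k) R := ⟨hint⟩
    rw [ringKrullDim_eq_of_isIntegral (R := MvPolynomial (Fin s) k) hg,
      ringKrullDim_mvPolynomial_fin]
  · let _ : Algebra (MvPolynomial (Fin s) k) R := g.toRingHom.toAlgebra
    have : Algebra.IsIntegral (MvPolynomial (Fin s) k) R := ⟨hint⟩
    have : IsScalarTower k (MvPolynomial (Fin s) k) R :=
      IsScalarTower.of_algebraMap_eq fun x => (g.commutes x).symm
    have : FaithfulSMul (MvPolynomial (Fin s) k) R :=
      (faithfulSMul_iff_algebraMap_injective _ _).2 hg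
    have h1 := trdeg_add_eq k (MvPolynomial (Fin s) k) (A := R)
    rw [trdeg_eq_zero (R := MvPolynomial (Fin s) k) (A := R), add_zero, MvPolynomial.trdeg_of_isDomain] at h1
    simpa using h1.symm

/-- The quotient by the kernel of a map into a polynomial ring in `ι` has dimension `≤ |ι|`. -/
theorem ringKrullDim_quotient_ker_le {k σ ι : Type} [Field k] [Finite σ] [Fintype ι]
    (φ : MvPolynomial σ k →ₐ[k] MvPolynomial ι k) :
    ringKrullDim (MvPolynomial σ k ⧸ RingHom.ker φ) ≤ Fintype.card ι := by
  have : (RingHom.ker φ).IsPrime := RingHom.ker_isPrime φ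
  obtain ⟨s, h1, h2⟩ := ringKrullDim_eq_trdeg k (MvPolynomial σ k ⧸ RingHom.ker φ)
  have h3 := trdeg_le_of_injective (Ideal.kerLiftAlg φ) (Ideal.kerLiftAlg_injective φ)
  rw [h2, MvPolynomial.trdeg_of_isDomain] at h3
  rw [h1]
  simp only [Cardinal.mk_fintype, Cardinal.lift_natCast, Nat.cast_le] at h3
  exact_mod_cast h3

/-- A finitely generated algebra containing a polynomial ring in `ι` has dimension `≥ |ι|`. -/
theorem card_le_ringKrullDim {k R ι : Type} [Field k] [CommRing R] [Algebra k R]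
    [Algebra.FiniteType k R] [Fintype ι] (φ : MvPolynomial ι k →ₐ[k] R)
    (hφ : Function.Injective φ) : (Fintype.card ι : WithBot ℕ∞) ≤ ringKrullDim R := by
  -- `R` need not be a domain. A prime contracting to zero gives a quotient that is one and still
  -- contains the polynomial ring.
  obtain ⟨P, hP, hPc⟩ := Ideal.exists_comap_eq_of_mem_minimalPrimes_of_injective
    (f := φ.toRingHom) hφ ⊥ (by
      rw [IsDomain.minimalPrimes_eq_singleton_bot]
      rfl)
  refine le_trans ?_ (ringKrullDim_quotient_le P)
  obtain ⟨s, h1, h2⟩ := ringKrullDim_eq_trdeg k (R ⧸ P)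
  have hinj : Function.Injective ((Ideal.Quotient.mkₐ k P).comp φ) := by
    rw [injective_iff_map_eq_zero]
    intro a ha
    have h3 : φ a ∈ P := Ideal.Quotient.eq_zero_iff_mem.1 ha
    have h4 : a ∈ P.comap φ.toRingHom := h3
    rwa [hPc] at h4
  have h3 := trdeg_le_of_injective _ hinj
  rw [h2, MvPolynomial.trdeg_of_isDomain] at h3
  rw [h1]
  simp only [Cardinal.mk_fintype, Cardinal.lift_natCast, Nat.cast_le] at h3
  exact_mod_cast h3

/-! ### Vanishing ideals -/

/-- The coordinate ring of `Z` is a quotient of that of the closed image of the parametrisation with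
comorphism `φ`. -/
theorem varietyDim_le_of_ker_le {σ ι : Type} [Finite σ] [Fintype ι] {Z : Set (σ → ℂ)}
    (φ : MvPolynomial σ ℂ →ₐ[ℂ] MvPolynomial ι ℂ)
    (h : ∀ f, φ f = 0 → ∀ z ∈ Z, MvPolynomial.aeval z f = 0) :
    varietyDim Z ≤ Fintype.card ι := by
  have hle : (RingHom.ker φ : Ideal (MvPolynomial σ ℂ)) ≤ MvPolynomial.vanishingIdeal ℂ Z :=
    fun f hf => MvPolynomial.mem_vanishingIdeal_iff.2 (h f hf)
  exact (ringKrullDim_le_of_surjective (Ideal.Quotient.factor hle)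
    (Ideal.Quotient.factor_surjective hle)).trans (ringKrullDim_quotient_ker_le φ)

/-- The hypothesis says that the coordinates selected by `e` are algebraically independent on `Z`.
-/
theorem card_le_varietyDim {σ ι : Type} [Finite σ] [Fintype ι] {Z : Set (σ → ℂ)}
    (e : ι → σ)
    (h : ∀ f : MvPolynomial ι ℂ, (∀ z ∈ Z, MvPolynomial.aeval (z ∘ e) f = 0) → f = 0) :
    (Fintype.card ι : WithBot ℕ∞) ≤ varietyDim Z := by
  refine card_le_ringKrullDim (k := ℂ)
    ((Ideal.Quotient.mkₐ ℂ _).comp (MvPolynomial.rename e)) ?_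
  rw [injective_iff_map_eq_zero]
  intro f hf
  have h1 : MvPolynomial.rename e f ∈ MvPolynomial.vanishingIdeal ℂ Z :=
    Ideal.Quotient.eq_zero_iff_mem.1 hf
  refine h f fun z hz => ?_
  have h2 := MvPolynomial.mem_vanishingIdeal_iff.1 h1 z hz
  rwa [MvPolynomial.aeval_rename] at h2

theorem vanishingIdeal_zariskiClosure {σ : Type} (S : Set (σ → ℂ)) :
    MvPolynomial.vanishingIdeal ℂ (zariskiClosure S) =
      (MvPolynomial.vanishingIdeal ℂ S : Ideal (MvPolynomial σ ℂ)) := by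
  refine le_antisymm (MvPolynomial.vanishingIdeal_anti_mono
    (MvPolynomial.zeroLocus_vanishingIdeal_le S)) fun f hf => ?_
  exact MvPolynomial.mem_vanishingIdeal_iff.2 fun x hx => hx f hf

/-- Equations pull back along the projection, so the intermediate closure in the truncated tensor
algebra adds no condition. -/
theorem vanishingIdeal_tensorVariety {d : ℕ} (k : ℕ) (P : Set (ℝ → Fin d → ℝ)) :
    MvPolynomial.vanishingIdeal ℂ (tensorVariety k P) =
      (MvPolynomial.vanishingIdeal ℂ ((fun X => toLevel k (signature k X)) '' P) :
        Ideal (MvPolynomial (Fin k → Fin d) ℂ)) := by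
  rw [tensorVariety, vanishingIdeal_zariskiClosure]
  refine le_antisymm (MvPolynomial.vanishingIdeal_anti_mono ?_) fun f hf => ?_
  · rintro _ ⟨X, hX, rfl⟩
    exact ⟨signature k X, MvPolynomial.zeroLocus_vanishingIdeal_le _ ⟨X, hX, rfl⟩, rfl⟩
  · rw [MvPolynomial.mem_vanishingIdeal_iff]
    rintro _ ⟨x, hx, rfl⟩
    have h1 : MvPolynomial.rename (fun w => (⟨Fin.last k, w⟩ : Word d k)) f ∈
        MvPolynomial.vanishingIdeal ℂ (signature k '' P) := by
      rw [MvPolynomial.mem_vanishingIdeal_iff]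
      rintro _ ⟨X, hX, rfl⟩
      rw [MvPolynomial.aeval_rename]
      exact MvPolynomial.mem_vanishingIdeal_iff.1 hf _ ⟨X, hX, rfl⟩
    have h2 := hx _ h1
    rwa [MvPolynomial.aeval_rename] at h2

theorem varietyDim_tensorVariety {d : ℕ} (k : ℕ) (P : Set (ℝ → Fin d → ℝ)) :
    varietyDim (tensorVariety k P) =
      varietyDim ((fun X => toLevel k (signature k X)) '' P) := by
  rw [varietyDim, varietyDim, vanishingIdeal_tensorVariety]

/-! ### The space of splines -/

/-- Normalised splines with pieces on `[0, h]`: they are continuous and vanish at `0`. -/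
def splineSpace {L : ℕ} (h : ℝ) (r : ℕ) (m : Fin (L + 1) → ℕ) (ρ : Fin (L + 1) → ℕ → ℝ) :
    Submodule ℝ (Fin (L + 1) → ℝ[X]) where
  carrier := {F | (∀ i, (F i).natDegree ≤ m i) ∧ (F 0).eval 0 = 0 ∧
    (∀ i : Fin L, (F i.castSucc).eval h = (F i.succ).eval 0) ∧
    ∀ i : Fin L, ∀ s, 1 ≤ s → s ≤ r → ρ i.castSucc s * (derivative^[s] (F i.castSucc)).eval h
      = (derivative^[s] (F i.succ)).eval 0}
  add_mem' {F G} hF hG := by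
    refine ⟨fun i => (natDegree_add_le _ _).trans (max_le (hF.1 i) (hG.1 i)), ?_, fun i => ?_,
      fun i s h1 h2 => ?_⟩
    · simp [hF.2.1, hG.2.1]
    · simp [hF.2.2.1, hG.2.2.1]
    · simp [iterate_map_add, mul_add, hF.2.2.2 i s h1 h2, hG.2.2.2 i s h1 h2]
  zero_mem' := by
    refine ⟨fun i => ?_, ?_, fun i => ?_, fun i s h1 h2 => ?_⟩ <;> simp
  smul_mem' c F hF := by
    refine ⟨fun i => (natDegree_smul_le _ _).trans (hF.1 i), ?_, fun i => ?_,
      fun i s h1 h2 => ?_⟩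
    · simp [hF.2.1]
    · simp [hF.2.2.1]
    · simp [iterate_derivative_smul, ← hF.2.2.2 i s h1 h2, mul_left_comm]

/-- The bilinear form `∫ F dG` on piecewise polynomials. -/
def pairing {L : ℕ} (h : ℝ) :
    (Fin (L + 1) → ℝ[X]) →ₗ[ℝ] (Fin (L + 1) → ℝ[X]) →ₗ[ℝ] ℝ :=
  LinearMap.mk₂ ℝ
    (fun F G => ∑ i, ∫ t in (0 : ℝ)..h, (F i).eval t * (derivative (G i)).eval t)
    (fun F F' G => by
      rw [← Finset.sum_add_distrib]
      refine Finset.sum_congr rfl fun i _ => ?_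
      rw [← intervalIntegral.integral_add
        (Continuous.intervalIntegrable (by fun_prop) _ _)
        (Continuous.intervalIntegrable (by fun_prop) _ _)]
      exact intervalIntegral.integral_congr fun t _ => by simp [add_mul])
    (fun c F G => by
      rw [smul_eq_mul, Finset.mul_sum]
      refine Finset.sum_congr rfl fun i _ => ?_
      rw [← intervalIntegral.integral_const_mul]
      exact intervalIntegral.integral_congr fun t _ => by simp [mul_assoc])
    (fun F G G' => by
      rw [← Finset.sum_add_distrib]
      refine Finset.sum_congr rfl fun i _ => ?_
      rw [← intervalIntegral.integral_add
        (Continuous.intervalIntegrable (by fun_prop) _ _)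
        (Continuous.intervalIntegrable (by fun_prop) _ _)]
      exact intervalIntegral.integral_congr fun t _ => by simp [mul_add])
    (fun c F G => by
      rw [smul_eq_mul, Finset.mul_sum]
      refine Finset.sum_congr rfl fun i _ => ?_
      rw [← intervalIntegral.integral_const_mul]
      exact intervalIntegral.integral_congr fun t _ => by simp [mul_left_comm])

theorem pairing_apply {L : ℕ} (h : ℝ) (F G : Fin (L + 1) → ℝ[X]) :
    pairing h F G = ∑ i, ∫ t in (0 : ℝ)..h, (F i).eval t * (derivative (G i)).eval t := rfl

/-- The value of a piecewise polynomial at the right end. -/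
def endValue {L : ℕ} (h : ℝ) : (Fin (L + 1) → ℝ[X]) →ₗ[ℝ] ℝ :=
  (Polynomial.leval h).comp (LinearMap.proj (Fin.last L))

theorem endValue_apply {L : ℕ} (h : ℝ) (F : Fin (L + 1) → ℝ[X]) :
    endValue h F = (F (Fin.last L)).eval h := rfl

/-- Extension of a finite sequence by zero. -/
def extend {L : ℕ} {α : Type*} [Zero α] (F : Fin (L + 1) → α) (i : ℕ) : α :=
  if hi : i < L + 1 then F ⟨i, hi⟩ else 0

@[simp] theorem extend_val {L : ℕ} {α : Type*} [Zero α] (F : Fin (L + 1) → α)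
    (i : Fin (L + 1)) : extend F (i : ℕ) = F i :=
  dif_pos i.2

/-- Continuity cancels the boundary terms at the knots. Neither the higher joining conditions nor
the weights enter. -/
theorem pairing_add_pairing {L : ℕ} {h : ℝ} {F G : Fin (L + 1) → ℝ[X]}
    (hF0 : (F 0).eval 0 = 0)
    (hF : ∀ i : Fin L, (F i.castSucc).eval h = (F i.succ).eval 0)
    (hG : ∀ i : Fin L, (G i.castSucc).eval h = (G i.succ).eval 0) :
    pairing h F G + pairing h G F = endValue h F * endValue h G := by
  have h1 := sum_integral_by_parts (h := h) (A := extend F) (B := extend G) (b := L)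
    (fun i hi => by
      have := hF ⟨i, hi⟩
      rwa [← extend_val F, ← extend_val F] at this)
    (fun i hi => by
      have := hG ⟨i, hi⟩
      rwa [← extend_val G, ← extend_val G] at this)
  rw [Finset.sum_range, Finset.sum_range] at h1
  have h2 : extend F L = F (Fin.last L) := extend_val F (Fin.last L)
  have h3 : extend G L = G (Fin.last L) := extend_val G (Fin.last L)
  have h4 : extend F 0 = F 0 := extend_val F 0
  simp only [extend_val, h2, h3, h4, hF0, zero_mul, sub_zero] at h1
  rw [pairing_apply, pairing_apply, endValue_apply, endValue_apply, ← h1]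
  congr 1
  refine Finset.sum_congr rfl fun i _ => intervalIntegral.integral_congr fun t _ => ?_
  exact mul_comm _ _

/-- Every test spline of degrees `< m i` and class `C^{r-1}` is the derivative of its own primitive,
which lies in the spline space. Orthogonality to the derivatives of the space is thus
`OrthToSplines`. -/
theorem eq_zero_of_pairing_eq_zero {L : ℕ} {h : ℝ} (hh : 0 < h) {r : ℕ} {m : Fin (L + 1) → ℕ}
    (hm : ∀ i, r ≤ m i) {F : Fin (L + 1) → ℝ[X]} (hF : F ∈ splineSpace h r m fun _ _ => 1)
    (h0 : ∀ G ∈ splineSpace h r m fun _ _ => 1, pairing h F G = 0) : F = 0 := by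
  obtain ⟨hdeg, hF0, hcont, hjoin⟩ := hF
  have key := eq_zero_of_orthToSplines hh (r := r) (b := L) (m := extend m) (F := extend F)
    (fun i hi => by simpa [extend, Nat.lt_succ_of_le hi] using hm _)
    (fun i hi => by simpa [extend, Nat.lt_succ_of_le hi] using hdeg _)
    (fun i hi s hs => by
      rcases Nat.eq_zero_or_pos s with rfl | hs0
      · have := hcont ⟨i, hi⟩
        rwa [← extend_val F, ← extend_val F] at this
      · have := hjoin ⟨i, hi⟩ s hs0 hs
        rwa [one_mul, ← extend_val F, ← extend_val F] at this)
    (by rw [show extend F 0 = F 0 from extend_val F 0, hF0])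
    (fun g hg hgj => by
      have hG : (fun i : Fin (L + 1) => primitive h g i) ∈ splineSpace h r m fun _ _ => 1 := by
        refine ⟨fun i => ?_, eval_zero_primitive_zero h g, fun i => eval_primitive_succ h g i,
          fun i s hs1 hs2 => ?_⟩
        · refine natDegree_primitive_le_of_degree_lt ?_
          have := hg i (by omega)
          rwa [extend_val] at this
        · obtain ⟨s, rfl⟩ : ∃ q, s = q + 1 := ⟨s - 1, by omega⟩
          simp only [Function.iterate_succ_apply, derivative_primitive, one_mul]
          exact hgj i i.2 s (by omega)
      have h1 := h0 _ hG
      rw [pairing_apply] at h1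
      rw [Finset.sum_range]
      simpa using h1)
  funext i
  have := key i (by omega)
  rwa [extend_val] at this

/-! ### Dimension of the spline space and nonvanishing of the end value -/

theorem coeff_eq_zero_of_eval_iterate_derivative {p : ℝ[X]} {s : ℕ}
    (h : (derivative^[s] p).eval 0 = 0) : p.coeff s = 0 := by
  rw [← coeff_zero_eq_eval_zero, coeff_iterate_derivative] at h
  simpa [Nat.factorial_ne_zero] using h

/-- The number of free coefficients of the `i`-th piece. -/
def freeCount {L : ℕ} (r : ℕ) (m : Fin (L + 1) → ℕ) (i : Fin (L + 1)) : ℕ :=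
  m i - if i = 0 then 0 else r

/-- The free coefficients of a spline. -/
def freeCoeffs {L : ℕ} (r : ℕ) (m : Fin (L + 1) → ℕ) :
    (Fin (L + 1) → ℝ[X]) →ₗ[ℝ] ((Σ i : Fin (L + 1), Fin (freeCount r m i)) → ℝ) :=
  LinearMap.pi fun x => (Polynomial.lcoeff ℝ ((x.2 : ℕ) + 1 + if x.1 = 0 then 0 else r)).comp
    (LinearMap.proj x.1)

/-- At each knot the Taylor coefficients of order `≤ r` are dictated by the preceding piece, and the
first constant term is 0. Only the free coefficients remain, whatever the weights. -/
theorem freeCoeffs_injective {L : ℕ} (h : ℝ) (r : ℕ) (m : Fin (L + 1) → ℕ)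
    (ρ : Fin (L + 1) → ℕ → ℝ) :
    Function.Injective ((freeCoeffs r m).comp (splineSpace h r m ρ).subtype) := by
  rw [injective_iff_map_eq_zero]
  rintro ⟨F, hdeg, hF0, hcont, hjoin⟩ hF
  have hfree : ∀ i : Fin (L + 1), ∀ k, (if i = 0 then 0 else r) < k → (F i).coeff k = 0 := by
    intro i k hk
    by_cases hkm : k ≤ m i
    · have := congrFun hF ⟨i, ⟨k - 1 - if i = 0 then 0 else r, by
        unfold freeCount
        omega⟩⟩
      simp only [freeCoeffs, LinearMap.comp_apply, LinearMap.pi_apply, LinearMap.proj_apply,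
        Polynomial.lcoeff_apply, Submodule.subtype_apply, Pi.zero_apply] at this
      rwa [show (k - 1 - if i = 0 then 0 else r) + 1 + (if i = 0 then 0 else r) = k by omega]
        at this
    · exact coeff_eq_zero_of_natDegree_lt (lt_of_le_of_lt (hdeg i) (not_le.1 hkm))
  have hall : ∀ i, F i = 0 := by
    intro i
    induction i using Fin.induction with
    | zero =>
      ext k
      rcases Nat.eq_zero_or_pos k with rfl | hk
      · rw [coeff_zero_eq_eval_zero, hF0, coeff_zero]
      · exact hfree 0 k (by simpa using hk)
    | succ i ih =>
      ext k
      by_cases hk : k ≤ r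
      · refine coeff_eq_zero_of_eval_iterate_derivative ?_
        rcases Nat.eq_zero_or_pos k with rfl | hk0
        · simp [← hcont i, ih]
        · simp [← hjoin i k hk0 hk, ih]
      · exact hfree i.succ k (by simpa using hk)
  exact Subtype.ext (funext hall)

theorem sum_freeCount {L r : ℕ} {m : Fin (L + 1) → ℕ} (hm : ∀ i, r ≤ m i) :
    ∑ i, freeCount r m i = ∑ i, m i - L * r := by
  have h1 : ∑ i : Fin L, freeCount r m i.succ + L * r = ∑ i : Fin L, m i.succ := by
    have : L * r = ∑ _i : Fin L, r := by simp
    rw [this, ← Finset.sum_add_distrib]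
    refine Finset.sum_congr rfl fun i _ => ?_
    have := hm i.succ
    simp [freeCount]
    omega
  have h2 : freeCount r m 0 = m 0 := by simp [freeCount]
  rw [Fin.sum_univ_succ, Fin.sum_univ_succ, h2]
  omega

instance splineSpace.finiteDimensional {L : ℕ} (h : ℝ) (r : ℕ) (m : Fin (L + 1) → ℕ)
    (ρ : Fin (L + 1) → ℕ → ℝ) : FiniteDimensional ℝ (splineSpace h r m ρ) :=
  FiniteDimensional.of_injective _ (freeCoeffs_injective h r m ρ)

/-- The conditions that cut out the spline space among all piecewise polynomials. -/
def splineConditions {L : ℕ} (h : ℝ) (r : ℕ) (ρ : Fin (L + 1) → ℕ → ℝ) :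
    (Fin (L + 1) → ℝ[X]) →ₗ[ℝ] ((Unit ⊕ Fin L × Fin (r + 1)) → ℝ) :=
  LinearMap.pi fun x => match x with
    | Sum.inl _ => (Polynomial.leval 0).comp (LinearMap.proj 0)
    | Sum.inr (i, s) =>
      (if (s : ℕ) = 0 then (1 : ℝ) else ρ i.castSucc s) •
          ((Polynomial.leval h).comp ((derivative ^ (s : ℕ)).comp (LinearMap.proj i.castSucc))) -
        (Polynomial.leval 0).comp ((derivative ^ (s : ℕ)).comp (LinearMap.proj i.succ))

/-- Rank-nullity: `∑ (m i + 1)` coefficients against `1 + L (r + 1)` linear conditions. -/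
theorem le_finrank_splineSpace {L : ℕ} (h : ℝ) {r : ℕ} {m : Fin (L + 1) → ℕ}
    (ρ : Fin (L + 1) → ℕ → ℝ) :
    ∑ i, m i - L * r ≤ Module.finrank ℝ (splineSpace h r m ρ) := by
  let incl : ((i : Fin (L + 1)) → degreeLT ℝ (m i + 1)) →ₗ[ℝ] (Fin (L + 1) → ℝ[X]) :=
    LinearMap.pi fun i => (degreeLT ℝ (m i + 1)).subtype.comp (LinearMap.proj i)
  have : ∀ i, FiniteDimensional ℝ (degreeLT ℝ (m i + 1)) := fun i =>
    FiniteDimensional.of_injective (degreeLTEquiv ℝ (m i + 1)).toLinearMap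
      (degreeLTEquiv ℝ (m i + 1)).injective
  let Φ := (splineConditions h r ρ).comp incl
  have h1 := LinearMap.finrank_range_add_finrank_ker Φ
  have h2 : Module.finrank ℝ (LinearMap.range Φ) ≤ 1 + L * (r + 1) := by
    refine (Submodule.finrank_le _).trans ?_
    simp
  have h3 : Module.finrank ℝ ((i : Fin (L + 1)) → degreeLT ℝ (m i + 1))
      = ∑ i, m i + (L + 1) := by
    rw [Module.finrank_pi_fintype]
    simp_rw [(degreeLTEquiv ℝ _).finrank_eq]
    simp [Finset.sum_add_distrib]
  have hker : ∀ x ∈ LinearMap.ker Φ, incl x ∈ splineSpace h r m ρ := by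
    intro x hx
    have hx' : ∀ y, splineConditions h r ρ (incl x) y = 0 := fun y => congrFun hx y
    refine ⟨fun i => ?_, ?_, fun i => ?_, fun i s h1 h2 => ?_⟩
    · have := mem_degreeLT.1 (x i).2
      exact natDegree_le_of_degree_le (Order.lt_succ_iff.1 (by exact_mod_cast this))
    · exact hx' (Sum.inl ())
    · have := hx' (Sum.inr (i, 0))
      simpa [splineConditions, sub_eq_zero] using this
    · have := hx' (Sum.inr (i, ⟨s, by omega⟩))
      simpa [splineConditions, sub_eq_zero, show s ≠ 0 by omega, Module.End.pow_apply] using this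
  let Ψ : LinearMap.ker Φ →ₗ[ℝ] splineSpace h r m ρ :=
    LinearMap.codRestrict _ (incl.comp (LinearMap.ker Φ).subtype) fun x => hker x x.2
  have hΨ : Function.Injective Ψ := by
    intro x y hxy
    have hxy' : incl x = incl y := congrArg Subtype.val hxy
    refine Subtype.ext (funext fun i => Subtype.ext (congrFun hxy' i))
  have h4 := LinearMap.finrank_le_finrank_of_injective hΨ
  have h5 : L * (r + 1) = L * r + L := by ring
  omega

/-- The witness has slope 1 on the pieces with `m i > 0` and is constant on the others. Pieces with
`m i = 0` force `r = 0`, where only continuity is required. -/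
theorem exists_endValue_ne_zero {L : ℕ} {h : ℝ} (hh : 0 < h) {r : ℕ} {m : Fin (L + 1) → ℕ}
    (hm : ∀ i, r ≤ m i) (hM : 0 < ∑ i, m i) :
    ∃ F ∈ splineSpace h r m fun _ _ => 1, endValue h F ≠ 0 := by
  let g : ℕ → ℝ[X] := fun i => if extend m i = 0 then 0 else 1
  have hg : ∀ i : Fin (L + 1), g i = if m i = 0 then 0 else 1 := fun i => by simp [g]
  refine ⟨fun i => primitive h g i, ⟨fun i => ?_, eval_zero_primitive_zero h g,
    fun i => eval_primitive_succ h g i, fun i s hs1 hs2 => ?_⟩, ?_⟩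
  · refine natDegree_primitive_le_of_degree_lt ?_
    rw [hg]
    split_ifs with h1
    · rw [degree_zero]
      exact WithBot.bot_lt_coe _
    · rw [degree_one]
      exact_mod_cast Nat.pos_of_ne_zero h1
  · obtain ⟨s, rfl⟩ : ∃ q, s = q + 1 := ⟨s - 1, by omega⟩
    have h1 : ∀ i, m i ≠ 0 := fun i => by have := hm i; omega
    have h2 := hg i.castSucc
    have h3 := hg i.succ
    simp only [Function.iterate_succ_apply, derivative_primitive, one_mul, h2, h3, h1, if_false]
    cases s <;> simp
  · have h1 : endValue h (fun i : Fin (L + 1) => primitive h g i)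
        = ∑ i : Fin (L + 1), (integ (g i)).eval h := by
      rw [endValue_apply, Fin.sum_univ_castSucc, primitive, eval_add, eval_C, Finset.sum_range]
      simp [add_comm]
    have h2 : ∀ i : Fin (L + 1), (integ (g i)).eval h = if m i = 0 then 0 else h := by
      intro i
      rw [hg]
      split_ifs <;> simp [integ]
    rw [h1, Finset.sum_congr rfl fun i _ => h2 i]
    obtain ⟨i, -, hi⟩ := Finset.exists_ne_zero_of_sum_ne_zero hM.ne'
    refine (Finset.sum_pos' (fun j _ => ?_) ⟨i, Finset.mem_univ i, ?_⟩).ne'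
    · split_ifs
      exacts [le_rfl, hh.le]
    · rw [if_neg hi]
      exact hh

/-! ### Level two signatures of splines -/

/-- Only open pieces enter the hypothesis: `f` will involve a derivative whose values at the knots
are meaningless but negligible. -/
theorem integral_piece {f : ℝ → ℝ} {R : ℕ → ℝ[X]} {h : ℝ} {b : ℕ}
    (hf : ∀ i < b, ∀ t ∈ Set.Ioo 0 h, f (i * h + t) = (R i).eval t) {i : ℕ} (hi : i < b)
    {t : ℝ} (ht : t ∈ Set.Icc 0 h) :
    IntervalIntegrable f volume (i * h) (i * h + t) ∧
      ∫ u in (i * h)..(i * h + t), f u = ∫ u in (0 : ℝ)..t, (R i).eval u := by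
  have hle : (i * h : ℝ) ≤ i * h + t := by linarith [ht.1]
  have hEq : Set.EqOn f (fun u => (R i).eval (u - i * h)) (Set.Ioo (i * h) (i * h + t)) := by
    intro u hu
    have := hf i hi (u - i * h) ⟨by linarith [hu.1], by linarith [hu.2, ht.2]⟩
    rwa [show i * h + (u - i * h) = u by ring] at this
  refine ⟨?_, ?_⟩
  · refine (intervalIntegrable_congr_uIoo (by rwa [Set.uIoo_of_le hle])).2 ?_
    exact Continuous.intervalIntegrable (by fun_prop) _ _
  · rw [intervalIntegral.integral_congr_Ioo_of_le hle hEq,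
      intervalIntegral.integral_comp_sub_right (fun u => (R i).eval u)]
    congr 1 <;> ring

theorem integral_pieces {f : ℝ → ℝ} {R : ℕ → ℝ[X]} {h : ℝ} (hh : 0 < h) {b : ℕ}
    (hf : ∀ i < b, ∀ t ∈ Set.Ioo 0 h, f (i * h + t) = (R i).eval t) {k : ℕ} (hk : k ≤ b) :
    IntervalIntegrable f volume 0 (k * h) ∧
      ∫ u in (0 : ℝ)..(k * h), f u
        = ∑ i ∈ Finset.range k, ∫ u in (0 : ℝ)..h, (R i).eval u := by
  induction k with
  | zero => simp
  | succ k ih =>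
    obtain ⟨h1, h2⟩ := ih (by omega)
    obtain ⟨h3, h4⟩ := integral_piece hf (show k < b by omega) (t := h) ⟨hh.le, le_rfl⟩
    rw [show ((k + 1 : ℕ) * h : ℝ) = k * h + h by push_cast; ring]
    refine ⟨h1.trans h3, ?_⟩
    rw [← intervalIntegral.integral_add_adjacent_intervals h1 h3, h2, h4, Finset.sum_range_succ]

theorem deriv_of_pieces {x : ℝ → ℝ} {P : ℕ → ℝ[X]} {h : ℝ} {b : ℕ}
    (hx : ∀ i < b, ∀ t ∈ Set.Icc 0 h, x (i * h + t) = (P i).eval t) :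
    ∀ i < b, ∀ t ∈ Set.Ioo 0 h, deriv x (i * h + t) = (derivative (P i)).eval t := by
  intro i hi t ht
  have h1 : x =ᶠ[nhds (i * h + t)] fun u => (P i).eval (u - i * h) := by
    have : Set.Ioo (i * h) (i * h + h) ∈ nhds (i * h + t) :=
      Ioo_mem_nhds (by linarith [ht.1]) (by linarith [ht.2])
    filter_upwards [this] with u hu
    have := hx i hi (u - i * h) ⟨by linarith [hu.1], by linarith [hu.2]⟩
    rwa [show i * h + (u - i * h) = u by ring] at this
  rw [h1.deriv_eq, deriv_comp_sub_const (f := fun u => (P i).eval u)]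
  simp

theorem integral_deriv_of_pieces {x : ℝ → ℝ} {P : ℕ → ℝ[X]} {h : ℝ} (hh : 0 < h) {b : ℕ}
    (hx : ∀ i < b, ∀ t ∈ Set.Icc 0 h, x (i * h + t) = (P i).eval t) {i : ℕ} (hi : i < b)
    {t : ℝ} (ht : t ∈ Set.Icc 0 h) :
    ∫ u in (0 : ℝ)..(i * h + t), deriv x u = x (i * h + t) - x 0 := by
  have hd := deriv_of_pieces hx
  have hstart : ∀ j ≤ i, ∫ u in (0 : ℝ)..(j * h), deriv x u = x (j * h) - x 0 := by
    intro j
    induction j with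
    | zero => simp
    | succ j ih =>
      intro hj
      have h1 := integral_pieces hh hd (k := j) (by omega)
      have h2 := integral_piece hd (i := j) (by omega) (t := h) ⟨hh.le, le_rfl⟩
      rw [show ((j + 1 : ℕ) * h : ℝ) = j * h + h by push_cast; ring,
        ← intervalIntegral.integral_add_adjacent_intervals h1.1 h2.1, ih (by omega), h2.2,
        integral_eval_derivative, ← hx j (by omega) h ⟨hh.le, le_rfl⟩,
        ← hx j (by omega) 0 ⟨le_rfl, hh.le⟩, add_zero]
      ring
  have h1 := integral_pieces hh hd (k := i) hi.le
  have h2 := integral_piece hd hi ht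
  rw [← intervalIntegral.integral_add_adjacent_intervals h1.1 h2.1, hstart i le_rfl, h2.2,
    integral_eval_derivative, ← hx i hi t ht, ← hx i hi 0 ⟨le_rfl, hh.le⟩, add_zero]
  ring

theorem integral_integral_deriv_of_pieces {x y : ℝ → ℝ} {P Q : ℕ → ℝ[X]} {h : ℝ} (hh : 0 < h)
    {b : ℕ} (hx : ∀ i < b, ∀ t ∈ Set.Icc 0 h, x (i * h + t) = (P i).eval t)
    (hy : ∀ i < b, ∀ t ∈ Set.Icc 0 h, y (i * h + t) = (Q i).eval t) (hx0 : x 0 = 0) :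
    ∫ s in (0 : ℝ)..(b * h), (∫ u in (0 : ℝ)..s, deriv x u) * deriv y s
      = ∑ i ∈ Finset.range b, ∫ t in (0 : ℝ)..h, (P i).eval t * (derivative (Q i)).eval t := by
  have h1 := (integral_pieces (f := fun s => (∫ u in (0 : ℝ)..s, deriv x u) * deriv y s)
    (R := fun i => P i * derivative (Q i)) hh (b := b) (fun i hi t ht => by
      rw [integral_deriv_of_pieces hh hx hi ⟨ht.1.le, ht.2.le⟩, hx0, sub_zero,
        deriv_of_pieces hy i hi t ht, hx i hi t ⟨ht.1.le, ht.2.le⟩, eval_mul]) le_rfl).2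
  simpa only [eval_mul] using h1

/-- Splines of regularity `r` with weights `ρ`. -/
def splinesWith (d r : ℕ) {ℓ : ℕ} (m : Fin ℓ → ℕ) (ρ : Fin ℓ → ℕ → ℝ) : Set (ℝ → Fin d → ℝ) :=
  {X | ∃ p : Fin ℓ → Fin d → ℝ[X], IsConcat p X ∧ (∀ i a, (p i a).natDegree ≤ m i) ∧
    SmoothAt r p ρ}

theorem signature_two_of_pieces {d L : ℕ} {h : ℝ} (hh : h = 1 / ((L + 1 : ℕ) : ℝ))
    {X : ℝ → Fin d → ℝ} {F : Fin d → Fin (L + 1) → ℝ[X]}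
    (hX : ∀ a, ∀ i : Fin (L + 1), ∀ t ∈ Set.Icc 0 h,
      X ((i : ℕ) * h + t) a - X 0 a = (F a i).eval t) (w : Fin 2 → Fin d) :
    toLevel 2 (signature 2 X) w = (pairing h (F (w 0)) (F (w 1)) : ℝ) := by
  have hpos : 0 < h := by rw [hh]; positivity
  have hpc : ∀ a, ∀ i < L + 1, ∀ t ∈ Set.Icc 0 h,
      X ((i : ℕ) * h + t) a - X 0 a = (extend (F a) i).eval t := by
    intro a i hi t ht
    have := hX a ⟨i, hi⟩ t ht
    rwa [← extend_val (F a)] at this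
  have h1 := integral_integral_deriv_of_pieces (x := fun u => X u (w 0) - X 0 (w 0))
    (y := fun u => X u (w 1) - X 0 (w 1)) hpos (hpc (w 0)) (hpc (w 1)) (sub_self _)
  simp only [deriv_sub_const_fun] at h1
  have h2 : ((L + 1 : ℕ) : ℝ) * h = 1 := by
    rw [hh]
    field_simp
  rw [h2, Finset.sum_range] at h1
  have h3 : iteratedIntegral X 2 w 1 = pairing h (F (w 0)) (F (w 1)) := by
    rw [pairing_apply]
    simp only [extend_val] at h1
    rw [← h1]
    simp [iteratedIntegral]
  rw [← h3]
  rfl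

/-- Shifting each piece by a constant passes between concatenations and continuous normalised
splines; derivatives of positive order are unaffected. -/
theorem image_splinesWith {d L r : ℕ} (m : Fin (L + 1) → ℕ) (ρ : Fin (L + 1) → ℕ → ℝ) {h : ℝ}
    (hh : h = 1 / ((L + 1 : ℕ) : ℝ)) :
    (fun Y => toLevel 2 (signature 2 Y)) '' splinesWith d r m ρ =
      {z | ∃ F : Fin d → splineSpace h r m ρ, z = fun w =>
        ((pairing h (F (w 0) : Fin (L + 1) → ℝ[X]) (F (w 1)) : ℝ) : ℂ)} := by
  have hpos : 0 < h := by rw [hh]; positivity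
  have hdiv : ∀ i : ℕ, (i : ℝ) / ((L + 1 : ℕ) : ℝ) = i * h := fun i => by rw [hh]; ring
  ext z
  constructor
  · rintro ⟨Y, ⟨p, ⟨hp0, hpc⟩, hdeg, hsm⟩, rfl⟩
    rw [← hh] at hpc
    let F : Fin d → Fin (L + 1) → ℝ[X] := fun a i =>
      p i a + C (Y ((i : ℕ) * h) a - (p i a).eval 0 - Y 0 a)
    have hX : ∀ a, ∀ i : Fin (L + 1), ∀ t ∈ Set.Icc 0 h,
        Y ((i : ℕ) * h + t) a - Y 0 a = (F a i).eval t := by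
      intro a i t ht
      have := hpc i t ht a
      rw [hdiv] at this
      simp only [F, eval_add, eval_C]
      rw [this]
      ring
    have hder : ∀ a i s, 1 ≤ s → derivative^[s] (F a i) = derivative^[s] (p i a) := by
      intro a i s hs
      obtain ⟨s, rfl⟩ : ∃ q, s = q + 1 := ⟨s - 1, by omega⟩
      simp [F, Function.iterate_succ_apply]
    have hF : ∀ a, F a ∈ splineSpace h r m ρ := by
      intro a
      refine ⟨fun i => ?_, ?_, fun i => ?_, fun i s hs1 hs2 => ?_⟩
      · refine (natDegree_add_le _ _).trans (max_le (hdeg i a) ?_)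
        rw [natDegree_C]
        exact Nat.zero_le _
      · rw [← hX a 0 0 ⟨le_rfl, hpos.le⟩]
        simp
      · rw [← hX a i.castSucc h ⟨hpos.le, le_rfl⟩, ← hX a i.succ 0 ⟨le_rfl, hpos.le⟩]
        congr 2
        simp only [Fin.val_castSucc, Fin.val_succ]
        push_cast
        ring
      · rw [hder _ _ _ hs1, hder _ _ _ hs1]
        have := hsm i.castSucc i.succ (by simp) s hs1 hs2 a
        rwa [← hh] at this
    exact ⟨fun a => ⟨F a, hF a⟩, funext fun w => signature_two_of_pieces hh hX w⟩
  · rintro ⟨F, rfl⟩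
    -- The constant tail supplies the correct value at the right end, where `glue` reads piece `L +
    -- 1`.
    let Q : Fin d → ℕ → ℝ[X] := fun a i =>
      if i < L + 1 then extend (F a : Fin (L + 1) → ℝ[X]) i else C (endValue h (F a).1)
    let Y : ℝ → Fin d → ℝ := fun u a => glue h (Q a) u
    have hQ : ∀ a, ∀ i : Fin (L + 1), Q a i = (F a).1 i := fun a i => by
      simp only [Q]
      rw [if_pos i.2, extend_val]
    have hX : ∀ a, ∀ i : Fin (L + 1), ∀ t ∈ Set.Icc 0 h,
        Y ((i : ℕ) * h + t) a = ((F a).1 i).eval t := by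
      intro a i t ht
      rcases eq_or_lt_of_le ht.2 with rfl | h1
      · have h2 := glue_add (Q a) ((i : ℕ) + 1) (t := 0) (h := t) ⟨le_rfl, hpos⟩
        rw [show (((i : ℕ) + 1 : ℕ) * t + 0 : ℝ) = (i : ℕ) * t + t by push_cast; ring] at h2
        simp only [Y]
        rw [h2]
        rcases Fin.eq_castSucc_or_eq_last i with ⟨j, rfl⟩ | rfl
        · have h3 := hQ a j.succ
          rw [Fin.val_succ] at h3
          rw [Fin.val_castSucc, h3, (F a).2.2.2.1 j]
        · simp [Q, endValue_apply]
      · simp only [Y]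
        rw [glue_add (Q a) i ⟨ht.1, h1⟩, hQ]
    have hX0 : ∀ a, Y 0 a = 0 := fun a => by
      have := hX a 0 0 ⟨le_rfl, hpos.le⟩
      rw [(F a).2.2.1] at this
      simpa using this
    refine ⟨Y, ⟨fun i a => (F a).1 i, ⟨fun i hi a => ?_, fun i t ht a => ?_⟩,
      fun i a => (F a).2.1 i, fun i j hij s hs1 hs2 a => ?_⟩, funext fun w => ?_⟩
    · have h1 : i = 0 := Fin.ext hi
      rw [hX0, h1, (F a).2.2.1]
    · rw [← hh] at ht
      have h1 := hX a i 0 ⟨le_rfl, hpos.le⟩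
      rw [add_zero] at h1
      rw [hdiv, hX a i t ht, h1]
      ring
    · rw [← hh]
      have hi : (i : ℕ) < L := by omega
      have h1 : i = (⟨i, hi⟩ : Fin L).castSucc := rfl
      have h2 : j = (⟨i, hi⟩ : Fin L).succ := Fin.ext hij
      rw [h1, h2]
      exact (F a).2.2.2.2 ⟨i, hi⟩ s hs1 hs2
    · exact signature_two_of_pieces (F := fun a => (F a).1) hh
        (fun a i t ht => by rw [hX a i t ht, hX0, sub_zero]) w

/-! ### A parametrisation of the matrices of rank at most `N` with rank one symmetric part -/

/-- The positions of the free entries of a `d × d` matrix of rank at most `N` whose symmetric part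
has rank one. -/
abbrev FreeEntry (d N : ℕ) : Type :=
  {q : Fin d × Fin d // (q.2 : ℕ) < N ∧ (q.1 ≤ q.2 ∨ N ≤ (q.1 : ℕ))}

theorem card_filter_freeEntry {d N b : ℕ} (hb : b < N) (hN : N ≤ d) :
    ((Finset.range d).filter fun a => b < N ∧ (a ≤ b ∨ N ≤ a)).card = b + 1 + (d - N) := by
  have : (Finset.range d).filter (fun a => b < N ∧ (a ≤ b ∨ N ≤ a))
      = Finset.range (b + 1) ∪ Finset.Ico N d := by
    ext a
    simp only [Finset.mem_filter, Finset.mem_range, Finset.mem_union, Finset.mem_Ico]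
    omega
  rw [this, Finset.card_union_of_disjoint, Finset.card_range, Nat.card_Ico]
  rw [Finset.disjoint_left]
  intro a ha hb
  simp only [Finset.mem_range, Finset.mem_Ico] at ha hb
  omega

theorem two_mul_card_freeEntry {d N : ℕ} (hN : N ≤ d) :
    2 * Fintype.card (FreeEntry d N) = N * (N + 1) + 2 * (N * (d - N)) := by
  have h1 : Fintype.card (FreeEntry d N) = ∑ b ∈ Finset.range N, (b + 1 + (d - N)) := by
    rw [Fintype.card_subtype, Finset.card_filter, Fintype.sum_prod_type_right]
    have h2 : ∀ b : Fin d, (∑ a : Fin d, if (b : ℕ) < N ∧ (a ≤ b ∨ N ≤ (a : ℕ)) then 1 else 0)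
        = if (b : ℕ) < N then (b : ℕ) + 1 + (d - N) else 0 := by
      intro b
      split_ifs with hb
      · rw [← card_filter_freeEntry hb hN, Finset.card_filter, Finset.sum_range]
        refine Finset.sum_congr rfl fun a _ => ?_
        simp only [Fin.le_def]
      · simp [hb]
    simp only
    rw [Finset.sum_congr rfl fun b _ => h2 b,
      Fin.sum_univ_eq_sum_range (fun b => if b < N then b + 1 + (d - N) else 0),
      ← Finset.sum_filter]
    congr 1
    ext b
    simp only [Finset.mem_filter, Finset.mem_range]
    omega
  rw [h1, Finset.sum_add_distrib, Finset.sum_add_distrib]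
  have h3 := Finset.sum_range_id_mul_two N
  rcases N with _ | N
  · simp
  · simp only [Finset.sum_const, Finset.card_range, smul_eq_mul, Nat.add_sub_cancel] at h3 ⊢
    nlinarith

/-- The `d × N` matrix with top block the identity and free entries below. -/
def modelFrame {R : Type*} [CommRing R] {d N : ℕ} (v : FreeEntry d N → R) (hN : N ≤ d) :
    Matrix (Fin d) (Fin N) R := fun a i =>
  if h : N ≤ (a : ℕ) then v ⟨(a, Fin.castLE hN i), i.2, Or.inr h⟩
  else if (a : ℕ) = i then 1 else 0

/-- The `N × N` matrix with symmetric part `c • e eᵀ` and prescribed skew part. -/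
def modelCore {R : Type*} [CommRing R] {d N : ℕ} (c : R) (v : FreeEntry d N → R) (hN : N ≤ d) :
    Matrix (Fin N) (Fin N) R := fun i j =>
  c * (v ⟨(Fin.castLE hN i, Fin.castLE hN i), i.2, Or.inl le_rfl⟩ *
      v ⟨(Fin.castLE hN j, Fin.castLE hN j), j.2, Or.inl le_rfl⟩) +
    if h : i < j then v ⟨(Fin.castLE hN i, Fin.castLE hN j), j.2, Or.inl h.le⟩
    else if h : j < i then -v ⟨(Fin.castLE hN j, Fin.castLE hN i), i.2, Or.inl h.le⟩
    else 0

/-- The parametrised matrix. -/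
def modelMatrix {R : Type*} [CommRing R] {d N : ℕ} (c : R) (v : FreeEntry d N → R) (hN : N ≤ d) :
    Matrix (Fin d) (Fin d) R :=
  modelFrame v hN * modelCore c v hN * (modelFrame v hN).transpose

theorem map_modelMatrix {R T : Type*} [CommRing R] [CommRing T] (g : R →+* T) {d N : ℕ} (c : R)
    (v : FreeEntry d N → R) (hN : N ≤ d) (a b : Fin d) :
    g (modelMatrix c v hN a b) = modelMatrix (g c) (fun q => g (v q)) hN a b := by
  have h1 : (modelFrame v hN).map g = modelFrame (fun q => g (v q)) hN := by
    ext a i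
    simp only [Matrix.map_apply, modelFrame]
    split_ifs <;> simp
  have h2 : (modelCore c v hN).map g = modelCore (g c) (fun q => g (v q)) hN := by
    ext i j
    simp only [Matrix.map_apply, modelCore, map_add, map_mul]
    split_ifs <;> simp
  have h3 : (modelMatrix c v hN).map g = modelMatrix (g c) (fun q => g (v q)) hN := by
    rw [modelMatrix, Matrix.map_mul, Matrix.map_mul, Matrix.transpose_map, h1, h2, modelMatrix]
  rw [← h3, Matrix.map_apply]

/-- The comorphism of the parametrisation. -/
def modelMap {d N : ℕ} (hN : N ≤ d) :
    MvPolynomial (Fin 2 → Fin d) ℂ →ₐ[ℂ] MvPolynomial (FreeEntry d N) ℂ :=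
  MvPolynomial.aeval fun w =>
    -- The factor `1 / 2` makes the core plus its transpose equal to `e eᵀ`.
    modelMatrix (MvPolynomial.C (1 / 2)) MvPolynomial.X hN (w 0) (w 1)

theorem aeval_modelMap {d N : ℕ} (hN : N ≤ d) (f : MvPolynomial (Fin 2 → Fin d) ℂ)
    (v : FreeEntry d N → ℂ) :
    MvPolynomial.aeval v (modelMap hN f) =
      MvPolynomial.aeval (fun w => modelMatrix (1 / 2) v hN (w 0) (w 1)) f := by
  rw [modelMap, ← AlgHom.comp_apply]
  congr 1
  refine MvPolynomial.algHom_ext fun w => ?_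
  rw [AlgHom.comp_apply, MvPolynomial.aeval_X, MvPolynomial.aeval_X]
  have := map_modelMatrix (MvPolynomial.aeval v : MvPolynomial _ ℂ →ₐ[ℂ] ℂ).toRingHom
    (MvPolynomial.C (1 / 2)) MvPolynomial.X hN (w 0) (w 1)
  simpa using this

/-- Every matrix with invertible frame lies in the image of the parametrisation. -/
theorem exists_modelMatrix_eq {d N : ℕ} (hN : N ≤ d) (A : Matrix (Fin d) (Fin N) ℂ)
    (S : Matrix (Fin N) (Fin N) ℂ) (e : Fin N → ℂ) (hS : ∀ i j, S i j + S j i = e i * e j)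
    (hA : IsUnit (A.submatrix (Fin.castLE hN) id).det) :
    ∃ v : FreeEntry d N → ℂ, modelMatrix (1 / 2) v hN = A * S * A.transpose := by
  -- Change of frame: `A S Aᵀ = (A T⁻¹) (T S Tᵀ) (A T⁻¹)ᵀ`, where `A T⁻¹` has identity top block and
  -- `e` becomes `T e`.
  set T := A.submatrix (Fin.castLE hN) id with hT
  set A' := A * T⁻¹ with hA'
  set S' := T * S * T.transpose with hS'
  set e' := T.mulVec e with he'
  have hTT : T⁻¹ * T = 1 := Matrix.nonsing_inv_mul T hA
  have hprod : A' * S' * A'.transpose = A * S * A.transpose := by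
    have h1 : A' * T = A := by rw [hA', Matrix.mul_assoc, hTT, Matrix.mul_one]
    calc A' * S' * A'.transpose = (A' * T) * S * (A' * T).transpose := by
          rw [hS', Matrix.transpose_mul A' T]
          simp only [Matrix.mul_assoc]
      _ = _ := by rw [h1]
  have hsym : ∀ i j, S' i j + S' j i = e' i * e' j := by
    have h1 : S + S.transpose = Matrix.vecMulVec e e := by
      ext i j
      simpa [Matrix.vecMulVec_apply] using hS i j
    have h2 : S' + S'.transpose = Matrix.vecMulVec e' e' := by
      have : S' + S'.transpose = T * (S + S.transpose) * T.transpose := by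
        rw [hS']
        simp only [Matrix.transpose_mul, Matrix.transpose_transpose, Matrix.mul_add,
          Matrix.add_mul, Matrix.mul_assoc]
      rw [this, h1, Matrix.mul_vecMulVec, Matrix.vecMulVec_mul, Matrix.vecMul_transpose]
    intro i j
    have := congrFun (congrFun h2 i) j
    simpa [Matrix.vecMulVec_apply] using this
  have htop : ∀ i j : Fin N, A' (Fin.castLE hN i) j = if i = j then 1 else 0 := by
    intro i j
    have h1 : A'.submatrix (Fin.castLE hN) id = T * T⁻¹ := by
      ext i j
      simp [hA', hT, Matrix.mul_apply]
    rw [Matrix.mul_nonsing_inv T hA] at h1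
    have := congrFun (congrFun h1 i) j
    simpa [Matrix.one_apply] using this
  let v : FreeEntry d N → ℂ := fun q =>
    if h : N ≤ (q.1.1 : ℕ) then A' q.1.1 ⟨q.1.2, q.2.1⟩
    else if q.1.1 = q.1.2 then e' ⟨q.1.2, q.2.1⟩
    else S' ⟨q.1.1, not_le.1 h⟩ ⟨q.1.2, q.2.1⟩ -
      1 / 2 * (e' ⟨q.1.1, not_le.1 h⟩ * e' ⟨q.1.2, q.2.1⟩)
  have hframe : modelFrame v hN = A' := by
    ext a i
    simp only [modelFrame, v]
    split_ifs with h1 h2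
    · simp
    · have h3 := htop i i
      rw [if_pos rfl] at h3
      rw [show a = Fin.castLE hN i from Fin.ext h2, h3]
    · have h3 := htop ⟨a, by omega⟩ i
      rw [if_neg (fun h => h2 (by rw [← h]))] at h3
      exact h3.symm
  have hdiag : ∀ i : Fin N, v ⟨(Fin.castLE hN i, Fin.castLE hN i), i.2, Or.inl le_rfl⟩ = e' i := by
    intro i
    have : ¬ N ≤ (i : ℕ) := by omega
    simp [v, this]
  have hupper : ∀ i j : Fin N, ∀ h : i < j,
      v ⟨(Fin.castLE hN i, Fin.castLE hN j), j.2, Or.inl h.le⟩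
        = S' i j - 1 / 2 * (e' i * e' j) := by
    intro i j h
    have h1 : ¬ N ≤ (i : ℕ) := by omega
    simp [v, h1, h.ne]
  have hcore : modelCore (1 / 2) v hN = S' := by
    ext i j
    simp only [modelCore, hdiag]
    split_ifs with h1 h2
    · rw [hupper i j h1]
      ring
    · rw [hupper j i h2]
      have := hsym i j
      linear_combination -this
    · obtain rfl : i = j := by omega
      have := hsym i i
      linear_combination -this / 2
  exact ⟨v, by rw [modelMatrix, hframe, hcore, hprod]⟩

/-- A singular top block `T` is perturbed to `T + t`, which is invertible off the finitely many
roots of the characteristic polynomial of `-T`. Continuity in `t` then gives the claim at `t = 0`.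
-/
theorem aeval_eq_zero_of_modelMap_eq_zero {d N : ℕ} (hN : N ≤ d)
    {f : MvPolynomial (Fin 2 → Fin d) ℂ} (hf : modelMap hN f = 0)
    (A : Matrix (Fin d) (Fin N) ℂ) (S : Matrix (Fin N) (Fin N) ℂ) (e : Fin N → ℂ)
    (hS : ∀ i j, S i j + S j i = e i * e j) :
    MvPolynomial.aeval (fun w => (A * S * A.transpose) (w 0) (w 1)) f = 0 := by
  let J : Matrix (Fin d) (Fin N) ℂ := fun a i => if (a : ℕ) = i then 1 else 0
  let At : ℂ → Matrix (Fin d) (Fin N) ℂ := fun t => A + t • J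
  let T := A.submatrix (Fin.castLE hN) id
  have hJ : ∀ a i, J a i = if (a : ℕ) = i then 1 else 0 := fun _ _ => rfl
  have hAtop : ∀ t, (At t).submatrix (Fin.castLE hN) id = Matrix.scalar (Fin N) t - (-T) := by
    intro t
    ext i j
    simp only [At, hJ, T, Matrix.submatrix_apply, Matrix.add_apply, Matrix.smul_apply,
      Matrix.sub_apply, Matrix.neg_apply, Matrix.scalar_apply, Matrix.diagonal_apply, id,
      Fin.val_castLE, smul_eq_mul, mul_ite, mul_one, mul_zero, Fin.ext_iff]
    ring
  have hgood : ∀ t, (-T).charpoly.eval t ≠ 0 →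
      MvPolynomial.aeval (fun w => (At t * S * (At t).transpose) (w 0) (w 1)) f = 0 := by
    intro t ht
    rw [Matrix.eval_charpoly, ← hAtop] at ht
    obtain ⟨v, hv⟩ := exists_modelMatrix_eq hN (At t) S e hS (Ne.isUnit ht)
    rw [← hv, ← aeval_modelMap, hf, map_zero]
  have hcont : Continuous fun t =>
      MvPolynomial.aeval (fun w : Fin 2 → Fin d => (At t * S * (At t).transpose) (w 0) (w 1)) f := by
    have h1 : Continuous fun t => fun w : Fin 2 → Fin d =>
        (At t * S * (At t).transpose) (w 0) (w 1) := by
      refine continuous_pi fun w => ?_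
      simp only [Matrix.mul_apply, Matrix.transpose_apply, At, Matrix.add_apply, Matrix.smul_apply]
      fun_prop
    exact (MvPolynomial.continuous_eval f).comp h1
  have hfin : {t | (-T).charpoly.eval t = 0}.Finite := by
    have := (-T).charpoly.roots.toFinset.finite_toSet
    refine this.subset fun t ht => ?_
    simpa [(Matrix.charpoly_monic (-T)).ne_zero] using ht
  have hdense : Dense {t | (-T).charpoly.eval t = 0}ᶜ := hfin.countable.dense_compl ℂ
  have hclosed := isClosed_singleton (x := (0 : ℂ)).preimage hcont
  have huniv := hclosed.closure_subset_iff.2 (fun t ht => hgood t ht : {t | (-T).charpoly.eval t = 0}ᶜ ⊆ _)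
  have h0 := huniv (hdense 0)
  simpa [At] using h0

/-- The matrices of a bilinear form with rank one symmetric part on a space that embeds in `ℝ^n`
factor through size `min n d`. -/
theorem exists_factorisation {V : Type*} [AddCommGroup V] [Module ℝ V] (B : V →ₗ[ℝ] V →ₗ[ℝ] ℝ)
    (e : V →ₗ[ℝ] ℝ) (hB : ∀ x y, B x y + B y x = e x * e y) {n d : ℕ}
    (g : V →ₗ[ℝ] (Fin n → ℝ)) (hg : Function.Injective g) (F : Fin d → V) :
    ∃ (A : Matrix (Fin d) (Fin (min n d)) ℝ) (S : Matrix (Fin (min n d)) (Fin (min n d)) ℝ)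
      (ε : Fin (min n d) → ℝ), (∀ i j, S i j + S j i = ε i * ε j) ∧
      ∀ a b, B (F a) (F b) = (A * S * A.transpose) a b := by
  rcases le_total n d with h | h
  · rw [min_eq_left h]
    obtain ⟨g', hg'⟩ := g.exists_leftInverse_of_injective (LinearMap.ker_eq_bot.2 hg)
    let x : Fin n → V := fun i => g' (Pi.single i 1)
    have hx : ∀ a, F a = ∑ i, g (F a) i • x i := by
      intro a
      have h1 : F a = g' (g (F a)) := (LinearMap.congr_fun hg' (F a)).symm
      conv_lhs => rw [h1, pi_eq_sum_univ' (g (F a))]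
      simp only [map_sum, map_smul, x]
    refine ⟨Matrix.of fun a i => g (F a) i, Matrix.of fun i j => B (x i) (x j), fun i => e (x i),
      fun i j => hB _ _, fun a b => ?_⟩
    conv_lhs => rw [hx a, hx b]
    simp only [map_sum, map_smul, LinearMap.sum_apply, LinearMap.smul_apply, smul_eq_mul,
      Matrix.mul_apply, Matrix.transpose_apply, Matrix.of_apply, Finset.sum_mul, Finset.mul_sum]
    refine Finset.sum_congr rfl fun j _ => Finset.sum_congr rfl fun i _ => ?_
    ring
  · rw [min_eq_right h]
    exact ⟨1, Matrix.of fun i j => B (F i) (F j), fun i => e (F i), fun i j => hB _ _,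
      fun a b => by simp⟩

/-! ### The Gram map of a nondegenerate form with rank one symmetric part -/

theorem span_setOf_ne_zero {V : Type*} [AddCommGroup V] [Module ℝ V] (e : V →ₗ[ℝ] ℝ)
    (he : e ≠ 0) : Submodule.span ℝ {v | e v ≠ 0} = ⊤ := by
  obtain ⟨w, hw⟩ : ∃ w, e w ≠ 0 := by
    by_contra! h
    exact he (LinearMap.ext h)
  refine eq_top_iff.2 fun v _ => ?_
  by_cases hv : e v = 0
  · have h1 : v + w ∈ Submodule.span ℝ {v | e v ≠ 0} :=
      Submodule.subset_span (by simpa [hv] using hw)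
    have h2 : w ∈ Submodule.span ℝ {v | e v ≠ 0} := Submodule.subset_span hw
    simpa using Submodule.sub_mem _ h1 h2
  · exact Submodule.subset_span hv

/-- There is a basis on which a nonzero functional does not vanish and in which a nonzero vector
has nonzero last coordinate. -/
theorem exists_adapted_basis {V : Type*} [AddCommGroup V] [Module ℝ V] [FiniteDimensional ℝ V]
    {e : V →ₗ[ℝ] ℝ} (he : e ≠ 0) {u : V} (hu : u ≠ 0) {k : ℕ}
    (hk : Module.finrank ℝ V = k) :
    ∃ b : Module.Basis (Fin k) ℝ V, (∀ i, e (b i) ≠ 0) ∧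
      ∀ i : Fin k, (i : ℕ) + 1 = k → b.repr u i ≠ 0 := by
  -- The vectors off the kernel of `e` span, so a basis can be chosen among them; a transposition
  -- then moves a nonzero coordinate of `u` to the last place.
  obtain ⟨T, hT, hspan, hli⟩ := exists_linearIndependent ℝ {v | e v ≠ 0}
  rw [span_setOf_ne_zero e he] at hspan
  let b₀ : Module.Basis T ℝ V := Module.Basis.mk hli (by simp [hspan])
  have : Fintype T := FiniteDimensional.fintypeBasisIndex b₀
  have hcard : Fintype.card T = k := by rw [← Module.finrank_eq_card_basis b₀, hk]
  let b₁ := b₀.reindex (Fintype.equivFinOfCardEq hcard)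
  have hb₁ : ∀ i, e (b₁ i) ≠ 0 := fun i => by
    simpa [b₁, b₀] using hT ((Fintype.equivFinOfCardEq hcard).symm i).2
  obtain ⟨j, hj⟩ : ∃ j, b₁.repr u j ≠ 0 := by
    by_contra! h
    exact hu (b₁.repr.map_eq_zero_iff.1 (Finsupp.ext h))
  have hkpos : 0 < k := j.pos
  refine ⟨b₁.reindex (Equiv.swap j ⟨k - 1, by omega⟩), fun i => ?_, fun i hi => ?_⟩
  · rw [Module.Basis.reindex_apply]
    exact hb₁ _
  · have hi' : i = ⟨k - 1, by omega⟩ := Fin.ext (by simp; omega)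
    rw [hi']
    simpa using hj

/-- A linear functional killing the differential of the Gram map at the standard frame is zero. -/
theorem coeff_eq_zero_of_gram_deriv {d N k : ℕ} (hNk : N ≤ k) (hNd : N ≤ d)
    (B : (Fin k → ℝ) →ₗ[ℝ] (Fin k → ℝ) →ₗ[ℝ] ℝ) (e : (Fin k → ℝ) →ₗ[ℝ] ℝ)
    (hB : ∀ x y, B x y + B y x = e x * e y) (hnd : ∀ x, (∀ y, B x y = 0) → x = 0)
    (he : ∀ i, e (Pi.single i 1) ≠ 0) (u : Fin k → ℝ) (hu : ∀ y, B u y = e y)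
    (hlast : ∀ i : Fin k, (i : ℕ) + 1 = k → u i ≠ 0) (x₀ : Fin d → Fin k → ℝ)
    (hx₀ : ∀ a i, x₀ a i = if (a : ℕ) = i ∧ (a : ℕ) < N then 1 else 0)
    (c : Fin d → Fin d → ℝ)
    (hc : ∀ a b : Fin d, ¬ ((b : ℕ) < N ∧ (a ≤ b ∨ N ≤ (a : ℕ))) → c a b = 0)
    (hzero : ∀ δ : Fin d → Fin k → ℝ,
      ∑ a, ∑ b, c a b * (B (x₀ a) (δ b) + B (δ a) (x₀ b)) = 0) : ∀ a b, c a b = 0 := by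
  -- Vary only the `j`-th vector of the frame.
  have hrow : ∀ (j : Fin d) (y : Fin k → ℝ),
      B (∑ a, c a j • x₀ a) y + B y (∑ b, c j b • x₀ b) = 0 := by
    intro j y
    have h1 := hzero (Pi.single j y)
    have h2 : ∀ a b, c a b * (B (x₀ a) ((Pi.single j y : Fin d → Fin k → ℝ) b) +
        B ((Pi.single j y : Fin d → Fin k → ℝ) a) (x₀ b))
        = (if b = j then c a b * B (x₀ a) y else 0) +
          if a = j then c a b * B y (x₀ b) else 0 := by
      intro a b
      by_cases hb : b = j <;> by_cases ha : a = j <;> simp [ha, hb, mul_add]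
    simp only [h2, Finset.sum_add_distrib, Finset.sum_ite_eq', Finset.mem_univ, if_true] at h1
    rw [Finset.sum_comm (f := fun a b => if a = j then c a b * B y (x₀ b) else 0)] at h1
    simp only [Finset.sum_ite_eq', Finset.mem_univ, if_true] at h1
    simpa using h1
  have hright : ∀ x, (∀ y, B y x = 0) → x = 0 := by
    intro x hx
    have h1 : e x = 0 := by
      have := hB x x
      rw [hx x, add_zero] at this
      exact mul_self_eq_zero.1 this.symm
    refine hnd x fun y => ?_
    have := hB x y
    rw [hx y, h1] at this
    simpa using this
  have hcoord : ∀ (g : Fin d → ℝ) (i : Fin k),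
      (∑ a, g a • x₀ a) i = if h : (i : ℕ) < N then g ⟨i, h.trans_le hNd⟩ else 0 := by
    intro g i
    rw [Finset.sum_apply]
    simp only [Pi.smul_apply, hx₀, smul_eq_mul, mul_ite, mul_one, mul_zero]
    split_ifs with h
    · rw [Finset.sum_eq_single ⟨i, h.trans_le hNd⟩]
      · simp [h]
      · intro a _ ha
        rw [if_neg]
        rintro ⟨h1, -⟩
        exact ha (Fin.ext h1)
      · simp
    · refine Finset.sum_eq_zero fun a _ => ?_
      rw [if_neg]
      omega
  have hsum0 : ∀ g : Fin d → ℝ, (∀ a, g a = 0) → ∑ a, g a • x₀ a = 0 := fun g hg =>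
    Finset.sum_eq_zero fun a _ => by rw [hg a, zero_smul]
  -- For `j ≥ N` column `j` of `c` has no free entry, so nondegeneracy on the right kills row `j`.
  have hlow : ∀ j : Fin d, N ≤ (j : ℕ) → ∀ b, c j b = 0 := by
    intro j hj b
    by_cases hb : (b : ℕ) < N
    · have h1 : ∑ b, c j b • x₀ b = 0 := by
        refine hright _ fun y => ?_
        have := hrow j y
        rwa [hsum0 (fun a => c a j) (fun a => hc a j (by omega)), map_zero, LinearMap.zero_apply,
          zero_add] at this
      have h2 := congrFun h1 ⟨b, by omega⟩
      rw [hcoord (fun b => c j b) ⟨b, by omega⟩] at h2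
      simpa [hb] using h2
    · exact hc j b (by omega)
  -- The columns `j < N` are treated from right to left. Once the later ones vanish, row `j` retains
  -- only its diagonal entry.
  have hup : ∀ s, ∀ j : Fin d, (j : ℕ) + s = N → 0 < s → ∀ a, c a j = 0 := by
    intro s
    induction s using Nat.strong_induction_on with
    | _ s ih =>
      intro j hj hs
      have h1 : ∀ b, b ≠ j → c j b = 0 := by
        intro b hb
        rcases lt_or_gt_of_ne hb with h | h
        · exact hc j b (by rw [Fin.lt_def] at h; rw [Fin.le_def]; omega)
        · by_cases hbN : (b : ℕ) < N
          · rw [Fin.lt_def] at h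
            exact ih (N - b) (by omega) b (by omega) (by omega) j
          · exact hc j b (by omega)
      have h2 : ∑ b, c j b • x₀ b = c j j • x₀ j :=
        Finset.sum_eq_single j (fun b _ hb => by rw [h1 b hb, zero_smul]) (by simp)
      have hxj : x₀ j = Pi.single ⟨j, by omega⟩ 1 := by
        ext i
        rw [hx₀, Pi.single_apply]
        congr 1
        rw [Fin.ext_iff, eq_iff_iff]
        simp only
        omega
      have hexj : e (x₀ j) ≠ 0 := by
        rw [hxj]
        exact he _
      -- Substituting `B(y, x_j) = e(x_j) e(y) - B(x_j, y)` and `e(y) = B(u, y)` turns the row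
      -- relation into `B(W, y) = 0`.
      set W := ∑ a, c a j • x₀ a - c j j • x₀ j + (c j j * e (x₀ j)) • u with hW
      have hW0 : W = 0 := by
        refine hnd W fun y => ?_
        have h3 := hrow j y
        rw [h2] at h3
        have h4 := hB (x₀ j) y
        simp only [map_smul, smul_eq_mul] at h3
        simp only [hW, map_add, map_sub, map_smul, LinearMap.add_apply, LinearMap.sub_apply,
          LinearMap.smul_apply, smul_eq_mul, hu]
        linear_combination h3 - c j j * h4
      have hWi : ∀ i : Fin k,
          (if h : (i : ℕ) < N then c ⟨i, h.trans_le hNd⟩ j else 0) -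
            (if (j : ℕ) = i then c j j else 0) + c j j * e (x₀ j) * u i = 0 := by
        intro i
        have h3 := congrFun hW0 i
        simp only [hW, Pi.add_apply, Pi.sub_apply, Pi.smul_apply, smul_eq_mul, Pi.zero_apply,
          hx₀ j i, hcoord (fun a => c a j) i] at h3
        have h4 : ((j : ℕ) = i ∧ (j : ℕ) < N) ↔ (j : ℕ) = i := by omega
        simpa [h4] using h3
      -- In the last coordinate of `W` the terms from `c` cancel or are not free, leaving `c j j * e
      -- (x₀ j)` times the nonzero last coordinate of `u`.
      have hcjj : c j j = 0 := by
        have h3 := hWi ⟨k - 1, by omega⟩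
        have h4 : (if h : k - 1 < N then c ⟨k - 1, h.trans_le hNd⟩ j else 0) -
            (if (j : ℕ) = k - 1 then c j j else 0) = 0 := by
          split_ifs with h5 h6 h6
          · have : (⟨k - 1, h5.trans_le hNd⟩ : Fin d) = j := Fin.ext h6.symm
            rw [this, sub_self]
          · rw [hc _ _ (by rw [Fin.le_def]; simp only; omega), sub_self]
          · omega
          · simp
        simp only [h4, zero_add, mul_eq_zero, hexj, or_false] at h3
        exact h3.resolve_right (hlast _ (by simp; omega))
      intro a
      rcases lt_trichotomy a j with h | h | h
      · rw [Fin.lt_def] at h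
        have h3 := hWi ⟨a, by omega⟩ 
        have h4 : ¬ (j : ℕ) = a := by omega
        simpa [hcjj, h4, show (a : ℕ) < N by omega] using h3
      · rw [h, hcjj]
      · rw [Fin.lt_def] at h
        by_cases haN : N ≤ (a : ℕ)
        · exact hlow a haN j
        · exact hc a j (by rw [Fin.le_def]; omega)
  intro a b
  by_cases hb : (b : ℕ) < N
  · exact hup (N - b) b (by omega) (by omega) a
  · exact hc a b (by omega)

/-- The Gram map, in the free entries, of a nondegenerate form with rank one symmetric part has
an image with interior points: it is a submersion at the standard frame of an adapted basis. -/
theorem exists_gram_open {d N k : ℕ} (hNk : N ≤ k) (hNd : N ≤ d)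
    (B : (Fin k → ℝ) →ₗ[ℝ] (Fin k → ℝ) →ₗ[ℝ] ℝ) (e : (Fin k → ℝ) →ₗ[ℝ] ℝ)
    (hB : ∀ x y, B x y + B y x = e x * e y) (hnd : ∀ x, (∀ y, B x y = 0) → x = 0)
    (he : ∀ i, e (Pi.single i 1) ≠ 0) (u : Fin k → ℝ) (hu : ∀ y, B u y = e y)
    (hlast : ∀ i : Fin k, (i : ℕ) + 1 = k → u i ≠ 0) :
    ∃ y : FreeEntry d N → ℝ,
      Set.range (fun (x : Fin d → Fin k → ℝ) (q : FreeEntry d N) => B (x q.1.1) (x q.1.2))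
        ∈ nhds y := by
  let x₀ : Fin d → Fin k → ℝ := fun a i => if (a : ℕ) = i ∧ (a : ℕ) < N then 1 else 0
  let Φ : (Fin d → Fin k → ℝ) → FreeEntry d N → ℝ := fun x q => B (x q.1.1) (x q.1.2)
  let Bc := B.toContinuousBilinearMap
  let pr : FreeEntry d N → (Fin d → Fin k → ℝ) →L[ℝ] (Fin k → ℝ) × (Fin k → ℝ) := fun q =>
    (ContinuousLinearMap.proj q.1.1).prod (ContinuousLinearMap.proj q.1.2)
  let D : (Fin d → Fin k → ℝ) →L[ℝ] (FreeEntry d N → ℝ) := ContinuousLinearMap.pi fun q =>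
    (Bc.isBoundedBilinearMap.deriv (x₀ q.1.1, x₀ q.1.2)).comp (pr q)
  have hstrict : HasStrictFDerivAt Φ D x₀ := by
    refine hasStrictFDerivAt_pi.2 fun q => ?_
    exact (Bc.isBoundedBilinearMap.hasStrictFDerivAt (x₀ q.1.1, x₀ q.1.2)).comp x₀
      (pr q).hasStrictFDerivAt
  -- A proper range would be killed by a nonzero functional, whose coefficients form a matrix `c`
  -- supported on the free entries.
  have hsurj : D.range = ⊤ := by
    by_contra hne
    obtain ⟨g, hg0, hg⟩ := Submodule.exists_le_ker_of_lt_top _ (lt_top_iff_ne_top.2 hne)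
    refine hg0 (LinearMap.pi_ext' fun q => LinearMap.ext_ring ?_)
    classical
    let c : Fin d → Fin d → ℝ := fun a b =>
      if h : (b : ℕ) < N ∧ (a ≤ b ∨ N ≤ (a : ℕ)) then g (Pi.single ⟨(a, b), h⟩ 1) else 0
    have hc : ∀ q : FreeEntry d N, c q.1.1 q.1.2 = g (Pi.single q 1) := fun q => by
      simp only [c]
      rw [dif_pos q.2]
    have hsum : ∀ G : Fin d → Fin d → ℝ,
        ∑ a, ∑ b, c a b * G a b = g fun q => G q.1.1 q.1.2 := by
      intro G
      rw [LinearMap.pi_apply_eq_sum_univ g, ← Fintype.sum_prod_type'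
        (f := fun a b => c a b * G a b)]
      have h1 : ∑ x : Fin d × Fin d, c x.1 x.2 * G x.1 x.2
          = ∑ x ∈ Finset.univ.filter
              (fun x : Fin d × Fin d => (x.2 : ℕ) < N ∧ (x.1 ≤ x.2 ∨ N ≤ (x.1 : ℕ))),
            c x.1 x.2 * G x.1 x.2 := by
        symm
        refine Finset.sum_filter_of_ne fun x _ hx => ?_
        by_contra hcon
        refine hx ?_
        simp only [c]
        rw [dif_neg hcon, zero_mul]
      rw [h1, Finset.sum_subtype (p := fun x : Fin d × Fin d =>
        (x.2 : ℕ) < N ∧ (x.1 ≤ x.2 ∨ N ≤ (x.1 : ℕ))) _ (by simp)]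
      refine Finset.sum_congr rfl fun q _ => ?_
      rw [hc, smul_eq_mul, mul_comm]
      congr 3
      ext r
      simp [Pi.single_apply, eq_comm]
    have hall := coeff_eq_zero_of_gram_deriv hNk hNd B e hB hnd he u hu hlast x₀
      (fun _ _ => rfl) c (fun a b h => dif_neg h) (fun δ => by
        rw [hsum fun a b => B (x₀ a) (δ b) + B (δ a) (x₀ b)]
        exact hg ⟨δ, rfl⟩)
    have := hall q.1.1 q.1.2
    rw [hc] at this
    simpa using this
  refine ⟨Φ x₀, ?_⟩
  rw [← hstrict.map_nhds_eq_of_surj hsurj, Filter.mem_map]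
  exact Filter.univ_mem' fun x => ⟨x, rfl⟩

/-- A real neighbourhood contains a product of infinite sets, on which a nonzero complex polynomial
cannot vanish. -/
theorem eq_zero_of_aeval_eq_zero_on_nhds {ι : Type} [Fintype ι] {f : MvPolynomial ι ℂ}
    {y : ι → ℝ} {U : Set (ι → ℝ)} (hU : U ∈ nhds y)
    (hf : ∀ x ∈ U, MvPolynomial.aeval (fun q => (x q : ℂ)) f = 0) : f = 0 := by
  obtain ⟨ε, hε, hball⟩ := Metric.mem_nhds_iff.1 hU
  refine MvPolynomial.funext_set (fun q => Complex.ofReal '' Metric.ball (y q) ε) (fun q => ?_)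
    fun x hx => ?_
  · exact (infinite_of_mem_nhds (y q) (Metric.ball_mem_nhds _ hε)).image
      Complex.ofReal_injective.injOn
  · choose t ht htx using fun q => hx q (Set.mem_univ q)
    have h1 : t ∈ U := hball ((dist_pi_lt_iff hε).2 ht)
    have h2 := hf t h1
    rw [show (fun q => (t q : ℂ)) = x from funext htx] at h2
    rw [map_zero]
    exact h2

/-- Nondegeneracy represents `e` as `B u`; a basis adapted to `e` and `u` transports the problem to
`exists_gram_open`. -/
theorem eq_zero_of_gram {V : Type*} [AddCommGroup V] [Module ℝ V] [FiniteDimensional ℝ V]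
    (B : V →ₗ[ℝ] V →ₗ[ℝ] ℝ) (e : V →ₗ[ℝ] ℝ) (hB : ∀ x y, B x y + B y x = e x * e y)
    (hnd : ∀ x, (∀ y, B x y = 0) → x = 0) {d N : ℕ} (hNd : N ≤ d)
    (hNk : N ≤ Module.finrank ℝ V) (he : 0 < N → e ≠ 0) {f : MvPolynomial (FreeEntry d N) ℂ}
    (hf : ∀ F : Fin d → V,
      MvPolynomial.aeval (fun q : FreeEntry d N => ((B (F q.1.1) (F q.1.2) : ℝ) : ℂ)) f = 0) :
    f = 0 := by
  rcases Nat.eq_zero_or_pos N with rfl | hN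
  · have : IsEmpty (FreeEntry d 0) := ⟨fun q => Nat.not_lt_zero _ q.2.1⟩
    have h1 := hf fun _ => 0
    rw [MvPolynomial.eq_C_of_isEmpty f] at h1 ⊢
    simpa using h1
  have he := he hN
  have hinj : Function.Injective B := by
    rw [injective_iff_map_eq_zero]
    exact fun x hx => hnd x fun y => by rw [hx, LinearMap.zero_apply]
  have hsurj : Function.Surjective B :=
    (LinearMap.injective_iff_surjective_of_finrank_eq_finrank
      (Subspace.dual_finrank_eq (K := ℝ) (V := V)).symm).1 hinj
  obtain ⟨u, hu⟩ := hsurj e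
  have hu0 : u ≠ 0 := by
    rintro rfl
    exact he (by rw [← hu, map_zero])
  obtain ⟨b, hb, hlast⟩ := exists_adapted_basis he hu0 rfl
  let φ := b.equivFun.symm
  have hφ : ∀ i, φ (Pi.single i 1) = b i := fun i => by simp [φ]
  obtain ⟨y, hy⟩ := exists_gram_open hNk hNd (B.compl₁₂ φ.toLinearMap φ.toLinearMap)
    (e.comp φ.toLinearMap) (fun x y => hB _ _) (fun x hx => by
      have : φ x = 0 := hnd _ fun y => by
        have := hx (φ.symm y)
        simpa using this
      exact (LinearEquiv.map_eq_zero_iff φ).1 this)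
    (fun i => by simpa [hφ] using hb i) (b.equivFun u) (fun y => by simp [φ, hu])
    (fun i hi => by simpa using hlast i hi)
  refine eq_zero_of_aeval_eq_zero_on_nhds hy ?_
  rintro _ ⟨x, rfl⟩
  exact hf fun a => φ (x a)

/-! ### The dimension of the varieties of signature matrices -/

/-- The upper bound holds for each choice of weights and the lower bound uses only unit weights, so
any class between the two has this dimension. -/
theorem varietyDim_eq_card {d r L : ℕ} {m : Fin (L + 1) → ℕ} (hm : ∀ i, r ≤ m i)
    {P : Set (ℝ → Fin d → ℝ)} (hP : ∀ X ∈ P, ∃ ρ, X ∈ splinesWith d r m ρ)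
    (hP' : splinesWith d r m (fun _ _ => 1) ⊆ P) :
    varietyDim (tensorVariety 2 P) =
      Fintype.card (FreeEntry d (min (∑ i, m i - L * r) d)) := by
  set n := ∑ i, m i - L * r with hn
  obtain ⟨h, hh⟩ : ∃ h : ℝ, h = 1 / ((L + 1 : ℕ) : ℝ) := ⟨_, rfl⟩
  have hpos : 0 < h := by rw [hh]; positivity
  have hNd : min n d ≤ d := min_le_right _ _
  have hsym : ∀ (ρ : Fin (L + 1) → ℕ → ℝ) (x y : splineSpace h r m ρ),
      pairing h x.1 y.1 + pairing h y.1 x.1 = endValue h x.1 * endValue h y.1 :=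
    fun ρ x y => pairing_add_pairing x.2.2.1 x.2.2.2.1 y.2.2.2.1
  rw [varietyDim_tensorVariety]
  refine le_antisymm ?_ ?_
  · refine varietyDim_le_of_ker_le (modelMap hNd) fun f hf z hz => ?_
    obtain ⟨X, hX, rfl⟩ := hz
    obtain ⟨ρ, hρ⟩ := hP X hX
    have h1 : toLevel 2 (signature 2 X) ∈
        (fun X => toLevel 2 (signature 2 X)) '' splinesWith d r m ρ := ⟨X, hρ, rfl⟩
    rw [image_splinesWith m ρ hh] at h1
    obtain ⟨F, hF⟩ := h1
    have hcard : Fintype.card (Σ i : Fin (L + 1), Fin (freeCount r m i)) = n := by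
      rw [Fintype.card_sigma]
      simp [sum_freeCount hm, hn]
    let E := LinearEquiv.funCongrLeft ℝ ℝ (Fintype.equivFinOfCardEq hcard).symm
    let g := E.toLinearMap.comp ((freeCoeffs r m).comp (splineSpace h r m ρ).subtype)
    have hg : Function.Injective g := fun x y hxy =>
      freeCoeffs_injective h r m ρ (E.injective hxy)
    obtain ⟨A, S, ε, hS, hAS⟩ := exists_factorisation
      ((pairing h).compl₁₂ (splineSpace h r m ρ).subtype (splineSpace h r m ρ).subtype)
      ((endValue h).comp (splineSpace h r m ρ).subtype) (hsym ρ) g hg F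
    have h2 := aeval_eq_zero_of_modelMap_eq_zero hNd hf (A.map Complex.ofRealHom)
      (S.map Complex.ofRealHom) (fun i => (ε i : ℂ)) (fun i j => by
        simp only [Matrix.map_apply, Complex.ofRealHom_eq_coe]
        exact_mod_cast hS i j)
    have h3 : (fun w : Fin 2 → Fin d => (A.map Complex.ofRealHom * S.map Complex.ofRealHom *
        (A.map Complex.ofRealHom).transpose) (w 0) (w 1)) = toLevel 2 (signature 2 X) := by
      rw [hF]
      funext w
      rw [← Matrix.transpose_map, ← Matrix.map_mul, ← Matrix.map_mul, Matrix.map_apply, ← hAS]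
      rfl
    rwa [h3] at h2
  · refine card_le_varietyDim (fun q : FreeEntry d (min n d) => ![q.1.1, q.1.2]) fun f hf => ?_
    refine eq_zero_of_gram
      ((pairing h).compl₁₂ (splineSpace h r m fun _ _ => 1).subtype
        (splineSpace h r m fun _ _ => 1).subtype)
      ((endValue h).comp (splineSpace h r m fun _ _ => 1).subtype) (hsym _) (fun x hx => ?_) hNd
      ((min_le_left _ _).trans (le_finrank_splineSpace h _)) (fun hN h0 => ?_) fun F => ?_
    · exact Subtype.ext (eq_zero_of_pairing_eq_zero hpos hm x.2 fun G hG => hx ⟨G, hG⟩)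
    · obtain ⟨F, hF, hF0⟩ := exists_endValue_ne_zero hpos hm (by
        have : 0 < n := lt_of_lt_of_le hN (min_le_left _ _)
        omega)
      exact hF0 (LinearMap.congr_fun h0 ⟨F, hF⟩)
    · have h1 : (fun w : Fin 2 → Fin d =>
          ((pairing h (F (w 0) : Fin (L + 1) → Polynomial ℝ) (F (w 1)) : ℝ) : ℂ)) ∈
          (fun X => toLevel 2 (signature 2 X)) '' splinesWith d r m (fun _ _ => 1) := by
        rw [image_splinesWith m _ hh]
        exact ⟨F, rfl⟩
      have h2 := hf _ (Set.image_mono hP' h1)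
      have h3 : ∀ q : FreeEntry d (min n d),
          (![q.1.1, q.1.2] : Fin 2 → Fin d) 0 = q.1.1 ∧
            (![q.1.1, q.1.2] : Fin 2 → Fin d) 1 = q.1.2 := fun q => ⟨rfl, rfl⟩
      simp only [Function.comp_def, h3] at h2
      exact h2

end SplineSignature

end

/-! ### The two dimension formulas -/

theorem mainTheorem9 (d r M ℓ : ℕ) (m : Fin ℓ → ℕ) (hm : SplineSignature.IsComp r M m) :
    (M - (ℓ - 1) * r ≤ d + 1 →
      ∃ D : ℕ,
        (D : ℤ) = (M : ℤ) * d - ((ℓ : ℤ) - 1) * d * r - ((M - (ℓ - 1) * r).choose 2 : ℕ) ∧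
        SplineSignature.varietyDim (SplineSignature.geometricVariety d 2 r m) = (D : WithBot ℕ∞) ∧
        SplineSignature.varietyDim (SplineSignature.parametricVariety d 2 r m)
          = (D : WithBot ℕ∞)) ∧
    (d ≤ M - (ℓ - 1) * r →
      SplineSignature.varietyDim (SplineSignature.geometricVariety d 2 r m)
        = ((d + 1).choose 2 : ℕ) ∧
      SplineSignature.varietyDim (SplineSignature.parametricVariety d 2 r m)
        = ((d + 1).choose 2 : ℕ)) := by
  obtain ⟨hℓ, hr, hM⟩ := hm
  obtain ⟨L, rfl⟩ : ∃ L, ℓ = L + 1 := ⟨ℓ - 1, by omega⟩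
  have hgeo : SplineSignature.varietyDim (SplineSignature.geometricVariety d 2 r m) = _ :=
    SplineSignature.varietyDim_eq_card hr (P := SplineSignature.geometricSplines d r m)
      (fun X ⟨p, h1, h2, ρ, _, h3⟩ => ⟨ρ, p, h1, h2, h3⟩)
      (fun X ⟨p, h1, h2, h3⟩ => ⟨p, h1, h2, _, fun _ _ => one_pos, h3⟩)
  have hpar : SplineSignature.varietyDim (SplineSignature.parametricVariety d 2 r m) = _ :=
    SplineSignature.varietyDim_eq_card hr (P := SplineSignature.parametricSplines d r m)
      (fun X hX => ⟨_, hX⟩) (fun X hX => hX)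
  rw [hgeo, hpar, hM, Nat.add_sub_cancel]
  have hle : L * r ≤ M := by
    have h1 : ∑ _i : Fin (L + 1), r ≤ ∑ i, m i := Finset.sum_le_sum fun i _ => hr i
    rw [hM, Finset.sum_const, Finset.card_univ, Fintype.card_fin, smul_eq_mul] at h1
    nlinarith
  obtain ⟨n, rfl⟩ : ∃ n, M = n + L * r := ⟨M - L * r, by omega⟩
  rw [Nat.add_sub_cancel]
  have hchoose : ∀ k : ℕ, ((k.choose 2 : ℕ) : ℤ) * 2 = k * (k - 1) := by
    intro k
    have h1 := Nat.cast_choose_two ℚ k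
    have h2 : ((k.choose 2 : ℕ) : ℚ) * 2 = k * (k - 1) := by
      rw [h1]
      ring
    exact_mod_cast h2
  have hbig : d ≤ n → Fintype.card (SplineSignature.FreeEntry d (min n d)) = (d + 1).choose 2 := by
    intro hd
    rw [min_eq_right hd]
    have h1 := SplineSignature.two_mul_card_freeEntry (le_refl d)
    have h2 := hchoose (d + 1)
    zify at h1 ⊢
    push_cast at h2
    rw [Nat.sub_self] at h1
    push_cast at h1
    linarith
  refine ⟨fun hn => ⟨Fintype.card (SplineSignature.FreeEntry d (min n d)), ?_, rfl, rfl⟩,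
    fun hd => ⟨by rw [hbig hd], by rw [hbig hd]⟩⟩
  have h2 := hchoose n
  rcases Nat.lt_or_ge d n with hd | hd
  · obtain rfl : n = d + 1 := by omega
    rw [hbig hd.le]
    push_cast at h2 ⊢
    linarith
  · rw [min_eq_left hd]
    have h1 := SplineSignature.two_mul_card_freeEntry hd
    zify [hd] at h1
    push_cast at h2 ⊢
    linarith
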